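/- Let $K$ be a compact metric space, let $C(K)$ be the Banach space of continuous complex-valued functions on $K$ with the supremum norm, and let $M(K)$ be the space of complex Borel measures on $K$ with the total variation norm. A closed subspace $X\subseteq C(K)$ is called *tight* if for every $g\in C(K)$ the operator $S_g:X\to C(K)/X$, $f\mapsto fg+X$, is weakly compact. A *band* is a closed subspace $\mathcal B\subseteq M(K)$ such that $\mu\in\mathcal B$, $\nu\in M(K)$ and $\nu\ll\mu$ imply $\nu\in\mathcal B$. Let $X^\perp=\{\mu\in M(K):\int f\,d\mu=0\text{ for all }f\in X\}$, and let $\mathcal B_{X^\perp}$ be the band generated by $X^\perp$, that is, the smallest band containing $X^\perp$. If $X\subseteq C(K)$ is tight, then the quotient space $\mathcal B_{X^\perp}/X^\perp$ is norm separable. Consequently $X^*$ is a separable distortion of an $L^1$-space: there are a separable Banach space $M$ and a measure space $(\Omega,\mu)$ such that $X^*$ is isometrically isomorphic to the $\ell^1$-direct sum $M\oplus_{\ell^1}L^1(\mu)$. -/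

import Mathlib

open MeasureTheory TopologicalSpace
open scoped ENNReal

noncomputable section

namespace TightSubspace

universe u

section Measures

variable {K : Type u} [MeasurableSpace K]

/-- The total variation `|μ|` of a complex measure is a finite measure. -/
instance isFiniteMeasure_variation (μ : ComplexMeasure K) : IsFiniteMeasure μ.variation := by
  have h : μ.variation ≤
      (ComplexMeasure.re μ).variation + (ComplexMeasure.im μ).variation := by
    apply VectorMeasure.variation_le_of_forall_enorm_le
    intro E _
    have h1 : ‖μ E‖ₑ ≤ ‖ComplexMeasure.re μ E‖ₑ + ‖ComplexMeasure.im μ E‖ₑ := by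
      have h2 : ‖μ E‖ ≤ ‖(μ E).re‖ + ‖(μ E).im‖ := by
        simpa using Complex.norm_le_abs_re_add_abs_im (μ E)
      calc ‖μ E‖ₑ = ENNReal.ofReal ‖μ E‖ := (ofReal_norm _).symm
        _ ≤ ENNReal.ofReal (‖(μ E).re‖ + ‖(μ E).im‖) := ENNReal.ofReal_le_ofReal h2
        _ = ‖(μ E).re‖ₑ + ‖(μ E).im‖ₑ := by
          rw [ENNReal.ofReal_add (norm_nonneg _) (norm_nonneg _), ofReal_norm,
            ofReal_norm]
    exact h1.trans (add_le_add (VectorMeasure.enorm_measure_le_variation _ _)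
      (VectorMeasure.enorm_measure_le_variation _ _))
  have hre : IsFiniteMeasure (ComplexMeasure.re μ).variation := by
    rw [← SignedMeasure.totalVariation_eq_variation]; infer_instance
  have him : IsFiniteMeasure (ComplexMeasure.im μ).variation := by
    rw [← SignedMeasure.totalVariation_eq_variation]; infer_instance
  exact isFiniteMeasure_of_le _ h

/-- The space `M(K)` of complex measures, normed by the total variation `‖μ‖ = |μ|(K)`. (On a
compact metric space with its Borel `σ`-algebra every complex measure is regular.) -/
instance instNormedAddCommGroupComplexMeasure : NormedAddCommGroup (ComplexMeasure K) :=
  AddGroupNorm.toNormedAddCommGroup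
    { toFun := fun μ => μ.variation.real Set.univ
      map_zero' := by simp
      add_le' := fun μ ν => by
        have h : (μ + ν).variation ≤ μ.variation + ν.variation :=
          VectorMeasure.variation_add_le
        have h' : (μ.variation + ν.variation).real Set.univ =
            μ.variation.real Set.univ + ν.variation.real Set.univ := measureReal_add_apply
        rw [← h']
        exact ENNReal.toReal_mono (measure_ne_top _ _) (h Set.univ)
      neg' := fun μ => by simp
      eq_zero_of_map_eq_zero' := fun μ h => by
        rw [measureReal_eq_zero_iff] at h
        rw [Measure.measure_univ_eq_zero] at h
        simpa using h }

theorem norm_eq_variation (μ : ComplexMeasure K) : ‖μ‖ = μ.variation.real Set.univ := rfl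

instance instNormedSpaceComplexMeasure : NormedSpace ℂ (ComplexMeasure K) where
  norm_smul_le c μ := by
    rw [norm_eq_variation, norm_eq_variation, VectorMeasure.variation_smul]
    rw [measureReal_def, measureReal_def, Measure.smul_apply, ENNReal.smul_def, smul_eq_mul,
      ENNReal.toReal_mul]
    rfl

/-- A band of measures: a closed linear subspace of `M(K)` that contains, with `μ`, every
`ν ∈ M(K)` such that `|ν| ≪ |μ|`. -/
def IsBand (B : Submodule ℂ (ComplexMeasure K)) : Prop :=
  IsClosed (B : Set (ComplexMeasure K)) ∧
    ∀ μ ∈ B, ∀ ν : ComplexMeasure K, ν.variation ≪ μ.variation → ν ∈ B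

/-- The band generated by a set of measures: the intersection of all bands containing it. -/
def generatedBand (S : Set (ComplexMeasure K)) : Submodule ℂ (ComplexMeasure K) :=
  sInf {B | IsBand B ∧ S ⊆ B}

theorem isBand_generatedBand (S : Set (ComplexMeasure K)) : IsBand (generatedBand S) := by
  constructor
  · rw [generatedBand, Submodule.coe_sInf]
    exact isClosed_biInter fun B hB => hB.1.1
  · intro μ hμ ν hν
    rw [generatedBand, Submodule.mem_sInf] at hμ ⊢
    exact fun B hB => hB.1.2 μ (hμ B hB) ν hν

theorem subset_generatedBand (S : Set (ComplexMeasure K)) : S ⊆ generatedBand S := by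
  intro μ hμ
  rw [SetLike.mem_coe, generatedBand, Submodule.mem_sInf]
  exact fun B hB => hB.2 hμ

/-- The integral `∫ f dμ` of a complex function against a complex measure. -/
def cintegral (μ : ComplexMeasure K) (f : K → ℂ) : ℂ :=
  μ.integral f (ContinuousLinearMap.mul ℝ ℂ)

theorem cintegral_smul (c : ℂ) (μ : ComplexMeasure K) {f : K → ℂ}
    (hf : Integrable f μ.variation) : cintegral (c • μ) f = c * cintegral μ f := by
  have hle : (c • μ).variation ≤ (‖c‖₊ : ℝ≥0∞) • μ.variation := by
    rw [VectorMeasure.variation_smul]; exact le_rfl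
  have hT : DominatedFinMeasAdditive μ.variation
      ((c • μ).transpose (ContinuousLinearMap.mul ℝ ℂ)) (‖c‖ * ‖ContinuousLinearMap.mul ℝ ℂ‖) := by
    refine ⟨fun s t hs ht _ _ hd => VectorMeasure.of_union hd hs ht, fun s hs hfin => ?_⟩
    have h3 := norm_cbmApplyMeasure_le (c • μ) (ContinuousLinearMap.mul ℝ ℂ) s
    have h4 : ‖μ s‖ ≤ μ.variation.real s :=
      VectorMeasure.norm_measure_le_variation (measure_ne_top _ _)
    have h5 : ‖(c • μ) s‖ = ‖c‖ * ‖μ s‖ := norm_smul c (μ s)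
    refine h3.trans ?_
    rw [h5, mul_assoc, mul_left_comm]
    gcongr
  have h1 : ∀ g : K → ℂ, Integrable g μ.variation →
      cintegral (c • μ) g = setToFun μ.variation _ hT g := fun g hg =>
    (setToFun_congr_measure_of_integrable _ (by simp) hle _ _ g hg).symm
  have h2 : ∀ (m : ComplexMeasure K) (s : Set K) (a : ℂ),
      m.transpose (ContinuousLinearMap.mul ℝ ℂ) s a = a * m s := fun _ _ _ => rfl
  rw [h1 f hf]
  unfold cintegral VectorMeasure.integral
  refine Integrable.induction (fun g => setToFun μ.variation _ hT g = c * setToFun μ.variation _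
    (dominatedFinMeasAdditive_cbmApplyMeasure μ (ContinuousLinearMap.mul ℝ ℂ)) g) ?_ ?_ ?_ ?_ hf
  · intro a s hs _
    rw [setToFun_indicator_const _ hs (measure_ne_top _ _),
      setToFun_indicator_const _ hs (measure_ne_top _ _), h2, h2, smul_apply, smul_eq_mul]
    ring
  · intro g h _ hg hh hg' hh'
    rw [setToFun_add _ hg hh, setToFun_add _ hg hh, hg', hh', mul_add]
  · exact isClosed_eq (continuous_setToFun _) (continuous_const.mul (continuous_setToFun _))
  · intro g h hgh _ hg
    rw [← setToFun_congr_ae _ hgh, ← setToFun_congr_ae _ hgh, hg]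

end Measures

section Tight

variable {K : Type u} [TopologicalSpace K] [CompactSpace K]

theorem integrable_of_continuous [MeasurableSpace K] [BorelSpace K] (μ : ComplexMeasure K)
    (f : C(K, ℂ)) : Integrable f μ.variation :=
  Integrable.of_bound (f.continuous.measurable.aestronglyMeasurable) ‖f‖
    (Filter.Eventually.of_forall f.norm_coe_le_norm)

/-- The annihilator `X^⊥ ⊆ M(K)`: the measures `μ` with `∫ f dμ = 0` for all `f ∈ X`. -/
def annihilator [MeasurableSpace K] [BorelSpace K] (X : Submodule ℂ C(K, ℂ)) :
    Submodule ℂ (ComplexMeasure K) where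
  carrier := {μ | ∀ f ∈ X, cintegral μ f = 0}
  zero_mem' := fun f _ => VectorMeasure.integral_zero_vectorMeasure
  add_mem' := by
    intro μ ν hμ hν f hf
    have h := VectorMeasure.integral_add_vectorMeasure (B := ContinuousLinearMap.mul ℝ ℂ)
      (integrable_of_continuous μ f) (integrable_of_continuous ν f)
    rw [cintegral, h]
    have h1 := hμ f hf
    have h2 := hν f hf
    rw [cintegral] at h1 h2
    rw [h1, h2, add_zero]
  smul_mem' := by
    intro c μ hμ f hf
    rw [cintegral_smul c μ (integrable_of_continuous μ f), hμ f hf, mul_zero]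

/-- A bounded operator is weakly compact if it maps the closed unit ball to a set whose closure in
the weak topology is weakly compact. -/
def IsWeaklyCompactOperator {E F : Type*} [NormedAddCommGroup E] [NormedSpace ℂ E]
    [SeminormedAddCommGroup F] [NormedSpace ℂ F] (T : E →L[ℂ] F) : Prop :=
  IsCompact (closure (toWeakSpace ℂ F '' (T '' Metric.closedBall 0 1)))

/-- The operator `S_g : X → C(K)/X`, `f ↦ f g + X`. -/
def hankelOperator (X : Submodule ℂ C(K, ℂ)) (g : C(K, ℂ)) : X →L[ℂ] (C(K, ℂ) ⧸ X) :=
  X.mkQL ∘L (ContinuousLinearMap.mul ℂ C(K, ℂ)).flip g ∘L X.subtypeL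

theorem hankelOperator_apply (X : Submodule ℂ C(K, ℂ)) (g : C(K, ℂ)) (f : X) :
    hankelOperator X g f = Submodule.Quotient.mk ((f : C(K, ℂ)) * g) := rfl

/-- A tight subspace of `C(K)`: a closed subspace for which every `S_g`, `g ∈ C(K)`, is weakly
compact. -/
def IsTight (X : Submodule ℂ C(K, ℂ)) : Prop :=
  IsClosed (X : Set C(K, ℂ)) ∧ ∀ g : C(K, ℂ), IsWeaklyCompactOperator (hankelOperator X g)

end Tight

/-- A Banach space is a separable distortion of an `L¹`-space if it is (isometrically) the
`ℓ¹`-direct sum of a separable Banach space and a space `L¹(μ)`. -/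
def IsSeparableDistortionOfL1 (Y : Type u) [NormedAddCommGroup Y] [NormedSpace ℂ Y] : Prop :=
  ∃ (M : Type u) (_ : NormedAddCommGroup M) (_ : NormedSpace ℂ M) (_ : CompleteSpace M)
    (Ω : Type u) (_ : MeasurableSpace Ω) (μ : Measure Ω),
    SeparableSpace M ∧ Nonempty (Y ≃ₗᵢ[ℂ] WithLp 1 (M × Lp ℂ 1 μ))

end TightSubspace

end

noncomputable section

namespace TightSubspace

universe u

open Filter Topology
open scoped NNReal CompactlySupported

/-! ### Densities, polar decomposition and integration against complex measures -/

section Density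

variable {K : Type*} [MeasurableSpace K]

/-! Write `B` for the band generated by `X^⊥`. By the Riesz theorem (`norm_toDual`,
`toDual_surjective`) `M(K)` is the dual of `C(K)`, so by Hahn–Banach `X^*` is `M(K)/X^⊥`
isometrically.

Separability. The dual of `C(K)/X` is `X^⊥`, and the adjoint of `S_g` sends `μ ∈ X^⊥` to the
restriction of `gμ` to `X`. The weak closure `W` of the image of the unit ball under `S_g` is weakly
compact, and it is metrizable because `C(K)/X` is separable. The norm of an adjoint image is at most
the supremum over `W`, and `C(W)` is separable, so the adjoint has separable range
(`IsWeaklyCompactOperator.isSeparable_range_adjoint`). Letting `g` run through a countable dense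
subset of `C(K)`, the restrictions to `X` of all `gμ`, with `g ∈ C(K)` and `μ ∈ X^⊥`, form a
separable set. The closed span of these `gμ` is invariant under multiplication by `C(K)`, hence a
band, because `C(K)` is dense in `L¹(|μ|)` (`isBand_comap_toDual`). So it contains `B`, and `B`
restricts to a separable subset of `X^*`. Since `X^⊥ ⊆ B`, the norm of `B/X^⊥` is the norm of that
restriction.

Distortion of `L¹`. Lebesgue decomposition with respect to `B`, and a maximal family of mutually
singular finite measures singular to `B`, give `M(K) = B ⊕₁ L¹(m)` (`IsBand.exists_l1_complement`).
As `X^⊥` lies in the first summand, passing to the quotient leaves the second one intact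
(`norm_restrictDual_add`), and `X^* = B/X^⊥ ⊕₁ L¹(m)`. -/

theorem norm_withDensityᵥ {m : Measure K} {f : K → ℂ} (hf : Integrable f m) :
    ‖(m.withDensityᵥ f : ComplexMeasure K)‖ = ∫ x, ‖f x‖ ∂m := by
  rw [norm_eq_variation, Measure.variation_withDensityᵥ hf, measureReal_def,
    withDensity_apply _ MeasurableSet.univ, Measure.restrict_univ,
    integral_norm_eq_lintegral_enorm hf.aestronglyMeasurable]

/-- The Radon-Nikodym theorem for complex measures. -/
theorem exists_eq_withDensityᵥ (μ : ComplexMeasure K) (m : Measure K) [SigmaFinite m]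
    (h : μ.variation ≪ m) : ∃ f : K → ℂ, Integrable f m ∧ μ = m.withDensityᵥ f := by
  have hμ : ∀ s, m s = 0 → μ s = 0 := fun s hs => by
    have h1 := VectorMeasure.enorm_measure_le_variation μ s
    rw [h hs] at h1
    simpa using h1
  have hre : (ComplexMeasure.re μ) ≪ᵥ m.toENNRealVectorMeasure := by
    refine VectorMeasure.AbsolutelyContinuous.mk fun s hs h0 => ?_
    rw [Measure.toENNRealVectorMeasure_apply_measurable hs] at h0
    change (μ s).re = 0
    rw [hμ s h0, Complex.zero_re]
  have him : (ComplexMeasure.im μ) ≪ᵥ m.toENNRealVectorMeasure := by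
    refine VectorMeasure.AbsolutelyContinuous.mk fun s hs h0 => ?_
    rw [Measure.toENNRealVectorMeasure_apply_measurable hs] at h0
    change (μ s).im = 0
    rw [hμ s h0, Complex.zero_im]
  refine ⟨μ.rnDeriv m, μ.integrable_rnDeriv m, ?_⟩
  have e1 := SignedMeasure.withDensityᵥ_rnDeriv_eq _ _ hre
  have e2 := SignedMeasure.withDensityᵥ_rnDeriv_eq _ _ him
  have hint := μ.integrable_rnDeriv m
  ext s hs
  rw [withDensityᵥ_apply hint hs]
  apply Complex.ext
  · rw [← RCLike.re_eq_complex_re, ← integral_re hint.integrableOn]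
    have := congrArg (fun v => v s) e1
    simp only [withDensityᵥ_apply (SignedMeasure.integrable_rnDeriv _ _) hs] at this
    exact this.symm
  · rw [← RCLike.im_eq_complex_im, ← integral_im hint.integrableOn]
    have := congrArg (fun v => v s) e2
    simp only [withDensityᵥ_apply (SignedMeasure.integrable_rnDeriv _ _) hs] at this
    exact this.symm

/-- The variation of the measure with density `f` with respect to `|μ|` has density `|f|`. It is
also `|μ|`, whose density is `1`, and densities are unique almost everywhere. -/
theorem exists_unimodular_density (μ : ComplexMeasure K) :
    ∃ f : K → ℂ, Integrable f μ.variation ∧ μ = μ.variation.withDensityᵥ f ∧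
      ∀ᵐ x ∂μ.variation, ‖f x‖ = 1 := by
  obtain ⟨f, hf, hμ⟩ := exists_eq_withDensityᵥ μ μ.variation Measure.AbsolutelyContinuous.rfl
  refine ⟨f, hf, hμ, ?_⟩
  have h1 : μ.variation.withDensity (fun x => ‖f x‖ₑ) = μ.variation.withDensity fun _ => 1 := by
    rw [← Measure.variation_withDensityᵥ hf, ← hμ]; exact withDensity_one.symm
  rw [withDensity_eq_iff hf.aestronglyMeasurable.enorm aemeasurable_const
    (ne_of_lt hf.2)] at h1
  filter_upwards [h1] with x hx
  rw [← toReal_enorm, hx]; simp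

theorem cintegral_const_indicator (μ : ComplexMeasure K) (c : ℂ) {s : Set K}
    (hs : MeasurableSet s) : cintegral μ (s.indicator fun _ => c) = c * μ s := by
  unfold cintegral VectorMeasure.integral
  rw [setToFun_indicator_const _ hs (measure_ne_top _ _)]
  rfl

theorem cintegral_add_right (μ : ComplexMeasure K) {f g : K → ℂ} (hf : Integrable f μ.variation)
    (hg : Integrable g μ.variation) :
    cintegral μ (f + g) = cintegral μ f + cintegral μ g :=
  VectorMeasure.integral_add hf hg

theorem cintegral_const_mul (μ : ComplexMeasure K) (c : ℂ) {f : K → ℂ}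
    (hf : Integrable f μ.variation) : cintegral μ (fun x => c * f x) = c * cintegral μ f := by
  refine Integrable.induction (fun g => cintegral μ (fun x => c * g x) = c * cintegral μ g)
    ?_ ?_ ?_ ?_ hf
  · intro a s hs _
    have : (fun x => c * s.indicator (fun _ => a) x) = s.indicator fun _ => c * a := by
      ext x; by_cases hx : x ∈ s <;> simp [hx]
    rw [this, cintegral_const_indicator μ _ hs, cintegral_const_indicator μ _ hs, mul_assoc]
  · intro g h _ hg hh hg' hh'
    have : (fun x => c * (g + h) x) = (fun x => c * g x) + fun x => c * h x := by
      ext x; simp [mul_add]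
    rw [this, cintegral_add_right μ (hg.const_mul c) (hh.const_mul c),
      cintegral_add_right μ hg hh, hg', hh', mul_add]
  · have h1 : ∀ g : K →₁[μ.variation] ℂ,
        cintegral μ (fun x => c * g x) = cintegral μ ((c • g : K →₁[μ.variation] ℂ)) := by
      intro g
      refine VectorMeasure.integral_congr_ae ?_
      filter_upwards [Lp.coeFn_smul c g] with x hx
      rw [hx]; rfl
    simp only [h1]
    exact isClosed_eq (VectorMeasure.continuous_integral.comp (continuous_const_smul c))
      (continuous_const.mul VectorMeasure.continuous_integral)
  · intro g h hgh _ hg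
    have e1 : cintegral μ g = cintegral μ h := VectorMeasure.integral_congr_ae hgh
    have e2 : cintegral μ (fun x => c * g x) = cintegral μ (fun x => c * h x) := by
      refine VectorMeasure.integral_congr_ae ?_
      filter_upwards [hgh] with x hx
      rw [hx]
    rw [← e1, ← e2, hg]

theorem norm_cintegral_le (μ : ComplexMeasure K) {f : K → ℂ} {C : ℝ}
    (hC : ∀ x, ‖f x‖ ≤ C) : ‖cintegral μ f‖ ≤ C * ‖μ‖ := by
  have h1 := VectorMeasure.norm_integral_le_integral_norm (μ := μ) (f := f)
    (B := ContinuousLinearMap.mul ℝ ℂ)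
  rw [ContinuousLinearMap.opNorm_mul, one_mul] at h1
  refine h1.trans ?_
  calc ∫ x, ‖f x‖ ∂μ.variation ≤ ∫ _, C ∂μ.variation :=
        integral_mono_of_nonneg (Eventually.of_forall fun x => norm_nonneg _)
          (integrable_const C) (Eventually.of_forall hC)
    _ = C * ‖μ‖ := by rw [integral_const, smul_eq_mul, mul_comm, norm_eq_variation]

/-- Linearity settles simple functions; uniformly bounded simple approximations of `f` then allow
dominated convergence on both sides. -/
theorem cintegral_withDensityᵥ {m : Measure K} {w : K → ℂ} (hw : Integrable w m)
    {f : K → ℂ} (hf : StronglyMeasurable f) {C : ℝ} (hC : ∀ x, ‖f x‖ ≤ C) :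
    cintegral (m.withDensityᵥ w) f = ∫ x, f x * w x ∂m := by
  have hsimple : ∀ g : SimpleFunc K ℂ,
      cintegral (m.withDensityᵥ w) g = ∫ x, g x * w x ∂m := by
    intro g
    induction g using SimpleFunc.induction with
    | @const c s hs =>
      classical
      rw [SimpleFunc.coe_piecewise, SimpleFunc.coe_const, SimpleFunc.coe_const,
        show s.piecewise (Function.const K c) (Function.const K 0) = s.indicator fun _ => c by
          ext x; by_cases hx : x ∈ s <;> simp [Set.piecewise, hx],
        cintegral_const_indicator _ _ hs, withDensityᵥ_apply hw hs, ← integral_const_mul,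
        ← integral_indicator hs]
      congr 1 with x
      by_cases hx : x ∈ s <;> simp [hx]
    | @add f g _ hf hg =>
      have hb : ∀ g : SimpleFunc K ℂ, Integrable g (m.withDensityᵥ w : ComplexMeasure K).variation :=
        fun g => SimpleFunc.integrable_of_isFiniteMeasure g
      have hb' : ∀ g : SimpleFunc K ℂ, Integrable (fun x => g x * w x) m := fun g => by
        obtain ⟨C, hC⟩ := g.exists_forall_norm_le
        exact hw.bdd_mul g.stronglyMeasurable.aestronglyMeasurable (c := C)
          (Eventually.of_forall hC)
      rw [SimpleFunc.coe_add, cintegral_add_right _ (hb f) (hb g), hf, hg,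
        ← integral_add (hb' f) (hb' g)]
      congr 1 with x
      simp [add_mul]
  have hC0 : 0 ≤ max C 0 := le_max_right _ _
  have hbd : ∀ n x, ‖hf.approxBounded (max C 0) n x‖ ≤ max C 0 := fun n x =>
    hf.norm_approxBounded_le hC0 n x
  have hlim : ∀ x, Tendsto (fun n => hf.approxBounded (max C 0) n x) atTop (𝓝 (f x)) := fun x =>
    hf.tendsto_approxBounded_of_norm_le ((hC x).trans (le_max_left _ _))
  have t1 : Tendsto (fun n => cintegral (m.withDensityᵥ w) (hf.approxBounded (max C 0) n)) atTop
      (𝓝 (cintegral (m.withDensityᵥ w) f)) :=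
    VectorMeasure.tendsto_integral_filter_of_norm_le_const
      (Eventually.of_forall fun n => (SimpleFunc.stronglyMeasurable _).aestronglyMeasurable)
      ⟨max C 0, Eventually.of_forall fun n => Eventually.of_forall (hbd n)⟩
      (Eventually.of_forall hlim)
  have t2 : Tendsto (fun n => ∫ x, hf.approxBounded (max C 0) n x * w x ∂m) atTop
      (𝓝 (∫ x, f x * w x ∂m)) := by
    refine tendsto_integral_of_dominated_convergence (fun x => max C 0 * ‖w x‖) (fun n =>
      (SimpleFunc.stronglyMeasurable _).aestronglyMeasurable.mul hw.aestronglyMeasurable)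
      (hw.norm.const_mul _) (fun n => Eventually.of_forall fun x => ?_)
      (Eventually.of_forall fun x => (hlim x).mul_const _)
    rw [norm_mul]
    exact mul_le_mul_of_nonneg_right (hbd n x) (norm_nonneg _)
  simp only [hsimple] at t1
  exact tendsto_nhds_unique t1 t2

/-- The total variation norm is additive on mutually singular measures. -/
theorem norm_add_of_mutuallySingular {μ ν : ComplexMeasure K}
    (h : μ.variation ⟂ₘ ν.variation) : ‖μ + ν‖ = ‖μ‖ + ‖ν‖ := by
  refine le_antisymm (norm_add_le _ _) ?_
  obtain ⟨s, hs, h1, h2⟩ := h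
  -- Since `μ = (μ + ν) - ν`, the variation of `μ` is at most that of the sum on the part that `ν`
  -- does not charge, and symmetrically for `ν`.
  have e1 : μ.variation ≤ (μ + ν).variation + ν.variation := by
    simpa using VectorMeasure.variation_sub_le (μ := μ + ν) (ν := ν)
  have e2 : ν.variation ≤ (μ + ν).variation + μ.variation := by
    simpa using VectorMeasure.variation_sub_le (μ := μ + ν) (ν := μ)
  have f1 : μ.variation sᶜ ≤ (μ + ν).variation sᶜ := by simpa [h2] using e1 sᶜ
  have f2 : ν.variation s ≤ (μ + ν).variation s := by simpa [h1] using e2 s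
  have g1 : μ.variation Set.univ = μ.variation sᶜ := by
    rw [← measure_add_measure_compl hs, h1, zero_add]
  have g2 : ν.variation Set.univ = ν.variation s := by
    rw [← measure_add_measure_compl hs, h2, add_zero]
  rw [norm_eq_variation, norm_eq_variation, norm_eq_variation, measureReal_def, measureReal_def,
    measureReal_def, ← ENNReal.toReal_add (measure_ne_top _ _) (measure_ne_top _ _)]
  refine ENNReal.toReal_mono (measure_ne_top _ _) ?_
  rw [g1, g2, ← measure_add_measure_compl hs, add_comm]
  exact add_le_add f2 f1

end Density

/-! ### Jordan decomposition and Riesz representation of real functionals -/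

section RealRiesz

variable {K : Type*} [TopologicalSpace K]

/-- The value on `f ≥ 0` of the positive part of a functional `φ` on `C(K, ℝ)`. -/
def posPartFunctional (φ : C(K, ℝ) →ₗ[ℝ] ℝ) (f : C(K, ℝ)) : ℝ :=
  sSup (φ '' Set.Icc 0 f)

variable {φ : C(K, ℝ) →ₗ[ℝ] ℝ} {C : ℝ}

theorem posPartFunctional_le {f : C(K, ℝ)} (hf : 0 ≤ f) {a : ℝ}
    (h : ∀ g ∈ Set.Icc 0 f, φ g ≤ a) : posPartFunctional φ f ≤ a := by
  refine csSup_le ⟨_, 0, ⟨le_rfl, hf⟩, rfl⟩ ?_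
  rintro _ ⟨g, hg, rfl⟩
  exact h g hg

variable [CompactSpace K]

theorem norm_le_norm_of_mem_Icc {f g : C(K, ℝ)} (h : g ∈ Set.Icc 0 f) : ‖g‖ ≤ ‖f‖ := by
  refine (ContinuousMap.norm_le _ (norm_nonneg _)).2 fun x => ?_
  have h0 : 0 ≤ g x := h.1 x
  have h1 : g x ≤ f x := h.2 x
  rw [Real.norm_of_nonneg h0]
  exact h1.trans ((le_abs_self _).trans (f.norm_coe_le_norm x))

theorem bddAbove_image_Icc (hφ : ∀ f, |φ f| ≤ C * ‖f‖) (hC : 0 ≤ C) (f : C(K, ℝ)) :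
    BddAbove (φ '' Set.Icc 0 f) := by
  refine ⟨C * ‖f‖, ?_⟩
  rintro _ ⟨g, hg, rfl⟩
  exact (le_abs_self _).trans ((hφ g).trans
    (mul_le_mul_of_nonneg_left (norm_le_norm_of_mem_Icc hg) hC))

theorem le_posPartFunctional (hφ : ∀ f, |φ f| ≤ C * ‖f‖) (hC : 0 ≤ C) {f g : C(K, ℝ)}
    (hg : g ∈ Set.Icc 0 f) : φ g ≤ posPartFunctional φ f :=
  le_csSup (bddAbove_image_Icc hφ hC f) ⟨g, hg, rfl⟩

/-- Riesz decomposition property: each `0 ≤ g ≤ f₁ + f₂` splits as `g ⊓ f₁` plus a remainder between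
`0` and `f₂`; conversely, sums of competitors are competitors. -/
theorem posPartFunctional_add (hφ : ∀ f, |φ f| ≤ C * ‖f‖) (hC : 0 ≤ C) {f₁ f₂ : C(K, ℝ)}
    (h₁ : 0 ≤ f₁) (h₂ : 0 ≤ f₂) :
    posPartFunctional φ (f₁ + f₂) = posPartFunctional φ f₁ + posPartFunctional φ f₂ := by
  apply le_antisymm
  · refine posPartFunctional_le (add_nonneg h₁ h₂) fun g hg => ?_
    have e : φ g = φ (g ⊓ f₁) + φ (g - g ⊓ f₁) := by rw [← map_add]; congr 1; abel
    rw [e]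
    refine add_le_add (le_posPartFunctional hφ hC ⟨le_inf hg.1 h₁, inf_le_right⟩)
      (le_posPartFunctional hφ hC ⟨sub_nonneg.2 inf_le_left, fun x => ?_⟩)
    have h3 : g x ≤ f₁ x + f₂ x := hg.2 x
    have h4 : 0 ≤ f₂ x := h₂ x
    change g x - min (g x) (f₁ x) ≤ f₂ x
    rcases min_cases (g x) (f₁ x) with h | h <;> linarith
  · rw [← le_sub_iff_add_le]
    refine posPartFunctional_le h₁ fun g₁ hg₁ => ?_
    rw [le_sub_iff_add_le, add_comm, ← le_sub_iff_add_le]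
    refine posPartFunctional_le h₂ fun g₂ hg₂ => ?_
    rw [le_sub_iff_add_le, ← map_add, add_comm]
    exact le_posPartFunctional hφ hC ⟨add_nonneg hg₁.1 hg₂.1, add_le_add hg₁.2 hg₂.2⟩

theorem posPartFunctional_smul (hφ : ∀ f, |φ f| ≤ C * ‖f‖) (hC : 0 ≤ C) {f : C(K, ℝ)}
    (hf : 0 ≤ f) {c : ℝ} (hc : 0 ≤ c) :
    posPartFunctional φ (c • f) = c * posPartFunctional φ f := by
  have key : ∀ {f : C(K, ℝ)} {c : ℝ}, 0 ≤ f → 0 < c →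
      posPartFunctional φ (c • f) ≤ c * posPartFunctional φ f := by
    intro f c hf hc
    refine posPartFunctional_le (smul_nonneg hc.le hf) fun g hg => ?_
    have e : φ g = c * φ (c⁻¹ • g) := by
      rw [map_smul, smul_eq_mul, mul_inv_cancel_left₀ hc.ne']
    rw [e]
    refine mul_le_mul_of_nonneg_left (le_posPartFunctional hφ hC
      ⟨smul_nonneg (inv_nonneg.2 hc.le) hg.1, ?_⟩) hc.le
    calc c⁻¹ • g ≤ c⁻¹ • c • f := smul_le_smul_of_nonneg_left hg.2 (inv_nonneg.2 hc.le)
      _ = f := inv_smul_smul₀ hc.ne' f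
  rcases hc.eq_or_lt with rfl | hc
  · have h0 := posPartFunctional_add hφ hC (le_refl 0) (le_refl 0)
    rw [zero_smul, zero_mul]
    rw [add_zero] at h0
    linarith
  · refine le_antisymm (key hf hc) ?_
    have h1 := key (smul_nonneg hc.le hf) (inv_pos.2 hc)
    rw [inv_smul_smul₀ hc.ne'] at h1
    calc c * posPartFunctional φ f ≤ c * (c⁻¹ * posPartFunctional φ (c • f)) :=
          mul_le_mul_of_nonneg_left h1 hc.le
      _ = _ := mul_inv_cancel_left₀ hc.ne' _

variable [T2Space K] [MeasurableSpace K] [BorelSpace K]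

/-- The Riesz representation theorem for a functional on the cone of nonnegative functions. -/
theorem exists_measure_of_cone_functional (q : C(K, ℝ) → ℝ)
    (hadd : ∀ f g, 0 ≤ f → 0 ≤ g → q (f + g) = q f + q g)
    (hsmul : ∀ (c : ℝ) f, 0 ≤ c → 0 ≤ f → q (c • f) = c * q f) (hpos : ∀ f, 0 ≤ f → 0 ≤ q f) :
    ∃ m : Measure K, IsFiniteMeasure m ∧ ∀ f : C(K, ℝ), 0 ≤ f → q f = ∫ x, f x ∂m := by
  let j : C_c(K, ℝ≥0) → C(K, ℝ) := fun f => ⟨fun x => (f x : ℝ), by fun_prop⟩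
  have hj : ∀ f, 0 ≤ j f := fun f x => (f x).coe_nonneg
  let Λ : C_c(K, ℝ≥0) →ₗ[ℝ≥0] ℝ≥0 :=
    { toFun := fun f => ⟨q (j f), hpos _ (hj f)⟩
      map_add' := fun f g => by
        apply NNReal.eq
        change q (j (f + g)) = q (j f) + q (j g)
        rw [← hadd _ _ (hj f) (hj g)]
        congr 1
      map_smul' := fun c f => by
        apply NNReal.eq
        change q (j (c • f)) = c * q (j f)
        rw [← hsmul _ _ c.coe_nonneg (hj f)]
        congr 1 }
  refine ⟨NNRealRMK.rieszMeasure Λ, inferInstance, fun f hf => ?_⟩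
  let f' : C_c(K, ℝ≥0) := ⟨⟨fun x => ⟨f x, hf x⟩, by fun_prop⟩, HasCompactSupport.of_compactSpace _⟩
  exact (NNRealRMK.integral_rieszMeasure Λ f').symm

/-- Both `φ⁺` and `φ⁺ - φ` are additive, homogeneous and nonnegative on the cone, so each is a
measure. The identity passes from the cone to all `f` through `f = f⁺ - f⁻`. -/
theorem exists_measure_sub_of_real_functional (hφ : ∀ f, |φ f| ≤ C * ‖f‖) (hC : 0 ≤ C) :
    ∃ m₁ m₂ : Measure K, IsFiniteMeasure m₁ ∧ IsFiniteMeasure m₂ ∧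
      ∀ f : C(K, ℝ), φ f = ∫ x, f x ∂m₁ - ∫ x, f x ∂m₂ := by
  obtain ⟨m₁, i₁, h₁⟩ := exists_measure_of_cone_functional (posPartFunctional φ)
    (fun f g hf hg => posPartFunctional_add hφ hC hf hg)
    (fun c f hc hf => posPartFunctional_smul hφ hC hf hc)
    (fun f hf => by simpa using le_posPartFunctional hφ hC (f := f) (g := 0) ⟨le_rfl, hf⟩)
  obtain ⟨m₂, i₂, h₂⟩ := exists_measure_of_cone_functional (fun f => posPartFunctional φ f - φ f)
    (fun f g hf hg => by rw [posPartFunctional_add hφ hC hf hg, map_add]; ring)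
    (fun c f hc hf => by rw [posPartFunctional_smul hφ hC hf hc, map_smul, smul_eq_mul]; ring)
    (fun f hf => sub_nonneg.2 (le_posPartFunctional hφ hC ⟨hf, le_rfl⟩))
  refine ⟨m₁, m₂, i₁, i₂, ?_⟩
  have hint : ∀ (m : Measure K) [IsFiniteMeasure m] (f : C(K, ℝ)), Integrable f m := fun m _ f =>
    Integrable.of_bound f.continuous.measurable.aestronglyMeasurable ‖f‖
      (Eventually.of_forall f.norm_coe_le_norm)
  have hnn : ∀ f, 0 ≤ f → φ f = ∫ x, f x ∂m₁ - ∫ x, f x ∂m₂ := fun f hf => by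
    rw [← h₁ f hf, ← h₂ f hf]; ring
  intro f
  have e : f = f⁺ - f⁻ := (posPart_sub_negPart f).symm
  have e' : ∀ m : Measure K, IsFiniteMeasure m →
      ∫ x, f x ∂m = ∫ x, (f⁺) x ∂m - ∫ x, (f⁻) x ∂m := fun m _ => by
    rw [← integral_sub (hint m _) (hint m _)]
    congr 1 with x
    exact congrArg (fun g => g x) e
  rw [e' m₁ i₁, e' m₂ i₂, e, map_sub, ← e, hnn _ (posPart_nonneg f), hnn _ (negPart_nonneg f)]
  ring

end RealRiesz

/-! ### `M(K)` as the dual of `C(K)` -/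

section Riesz

variable {K : Type*} [MetricSpace K] [CompactSpace K] [MeasurableSpace K] [BorelSpace K]

/-- The pairing of measures with continuous functions. -/
def toDual : ComplexMeasure K →ₗ[ℂ] StrongDual ℂ C(K, ℂ) where
  toFun μ := LinearMap.mkContinuous
    { toFun := fun f => cintegral μ f
      map_add' := fun f g =>
        cintegral_add_right μ (integrable_of_continuous μ f) (integrable_of_continuous μ g)
      map_smul' := fun c f => cintegral_const_mul μ c (integrable_of_continuous μ f) } ‖μ‖
    fun f => by rw [mul_comm]; exact norm_cintegral_le μ f.norm_coe_le_norm
  map_add' μ ν := by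
    ext f
    exact VectorMeasure.integral_add_vectorMeasure (B := ContinuousLinearMap.mul ℝ ℂ)
      (integrable_of_continuous μ f) (integrable_of_continuous ν f)
  map_smul' c μ := by
    ext f
    exact cintegral_smul c μ (integrable_of_continuous μ f)

theorem toDual_withDensityᵥ {m : Measure K} {w : K → ℂ} (hw : Integrable w m) (f : C(K, ℂ)) :
    toDual (m.withDensityᵥ w) f = ∫ x, f x * w x ∂m :=
  cintegral_withDensityᵥ hw f.continuous.stronglyMeasurable f.norm_coe_le_norm

theorem exists_continuousMap_integral_norm_sub_le {m : Measure K} [IsFiniteMeasure m] {v : K → ℂ}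
    (hv : Integrable v m) {ε : ℝ} (hε : 0 < ε) : ∃ g : C(K, ℂ), ∫ x, ‖v x - g x‖ ∂m ≤ ε := by
  obtain ⟨g, hg, -⟩ := hv.exists_boundedContinuous_integral_sub_le hε
  exact ⟨g.toContinuousMap, hg⟩

theorem integrable_continuousMap {m : Measure K} [IsFiniteMeasure m] (f : C(K, ℂ)) :
    Integrable f m :=
  Integrable.of_bound f.continuous.measurable.aestronglyMeasurable ‖f‖
    (Eventually.of_forall f.norm_coe_le_norm)

theorem norm_toDual_le (μ : ComplexMeasure K) : ‖toDual μ‖ ≤ ‖μ‖ :=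
  ContinuousLinearMap.opNorm_le_bound _ (norm_nonneg _) fun f => by
    rw [mul_comm]; exact norm_cintegral_le μ f.norm_coe_le_norm

/-- The radial retraction onto the unit disc moves `z` by `max (‖z‖ - 1) 0`, which is at most the
distance from `z` to a point of the unit circle. -/
theorem norm_sub_clip_le (z v : ℂ) (hv : ‖v‖ = 1) :
    ‖v - ((max 1 ‖z‖)⁻¹ : ℝ) • z‖ ≤ 2 * ‖v - z‖ := by
  have h1 : ‖z - ((max 1 ‖z‖)⁻¹ : ℝ) • z‖ ≤ ‖v - z‖ := by
    have hp : (0 : ℝ) < max 1 ‖z‖ := lt_max_of_lt_left one_pos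
    have e : z - ((max 1 ‖z‖)⁻¹ : ℝ) • z = (1 - (max 1 ‖z‖)⁻¹ : ℝ) • z := by
      rw [sub_smul, one_smul]
    have hle : (max 1 ‖z‖)⁻¹ ≤ 1 := inv_le_one_of_one_le₀ (le_max_left _ _)
    rw [e, norm_smul, Real.norm_of_nonneg (sub_nonneg.2 hle), sub_mul, one_mul]
    rcases le_total ‖z‖ 1 with h | h
    · rw [max_eq_left h]; simp
    · rw [max_eq_right h, inv_mul_cancel₀ (by linarith), ← hv, norm_sub_rev]
      exact norm_sub_norm_le _ _
  calc _ = ‖(v - z) + (z - ((max 1 ‖z‖)⁻¹ : ℝ) • z)‖ := by rw [sub_add_sub_cancel]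
    _ ≤ ‖v - z‖ + ‖v - z‖ := (norm_add_le _ _).trans (by gcongr)
    _ = _ := by ring

theorem norm_toDual (μ : ComplexMeasure K) : ‖toDual μ‖ = ‖μ‖ := by
  refine le_antisymm (norm_toDual_le μ) (le_of_forall_pos_le_add fun ε hε => ?_)
  obtain ⟨w, hw, hμ, hw1⟩ := exists_unimodular_density μ
  set m := μ.variation with hm
  have hv : Integrable (fun x => (starRingEnd ℂ) (w x)) m :=
    ⟨Complex.continuous_conj.comp_aestronglyMeasurable hw.aestronglyMeasurable,
      hw.2.mono (Eventually.of_forall fun x => by simp)⟩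
  obtain ⟨g, hg⟩ := exists_continuousMap_integral_norm_sub_le hv (half_pos hε)
  have hp : ∀ x, (0 : ℝ) < max 1 ‖g x‖ := fun x => lt_max_of_lt_left one_pos
  -- The ideal test function is the conjugate of the unimodular density, which gives exactly `‖μ‖`.
  -- Its continuous `L¹` approximation is clipped to the unit ball, at the cost of a factor `2` in
  -- the error.
  let h : C(K, ℂ) := ⟨fun x => ((max 1 ‖g x‖)⁻¹ : ℝ) • g x, by
    refine Continuous.smul (Continuous.inv₀ (by fun_prop) fun x => (hp x).ne') (by fun_prop)⟩
  have hh : ‖h‖ ≤ 1 := by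
    refine (ContinuousMap.norm_le _ zero_le_one).2 fun x => ?_
    change ‖((max 1 ‖g x‖)⁻¹ : ℝ) • g x‖ ≤ 1
    rw [norm_smul, norm_inv, Real.norm_of_nonneg (hp x).le, inv_mul_le_iff₀ (hp x), mul_one]
    exact le_max_right _ _
  have hhw : Integrable (fun x => h x * w x) m :=
    hw.bdd_mul h.continuous.stronglyMeasurable.aestronglyMeasurable (c := 1)
      (Eventually.of_forall fun x => (h.norm_coe_le_norm x).trans hh)
  have e1 : ((‖μ‖ : ℝ) : ℂ) = ∫ x, (starRingEnd ℂ) (w x) * w x ∂m := by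
    have : (fun x => (starRingEnd ℂ) (w x) * w x) =ᵐ[m] fun _ => (1 : ℂ) := by
      filter_upwards [hw1] with x hx
      rw [Complex.conj_mul', hx]; simp
    rw [integral_congr_ae this, integral_const, norm_eq_variation]; simp [hm]
  have e2 : toDual μ h = ∫ x, h x * w x ∂m := by
    conv_lhs => rw [hμ]
    exact toDual_withDensityᵥ hw h
  have hcw : Integrable (fun x => (starRingEnd ℂ) (w x) * w x) m := by
    refine (integrable_const (1 : ℂ)).congr ?_
    filter_upwards [hw1] with x hx
    rw [Complex.conj_mul', hx]; simp
  have e3 : ‖((‖μ‖ : ℝ) : ℂ) - toDual μ h‖ ≤ ε := by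
    rw [e1, e2, ← integral_sub hcw hhw]
    refine (norm_integral_le_integral_norm _).trans ?_
    calc ∫ x, ‖(starRingEnd ℂ) (w x) * w x - h x * w x‖ ∂m
        ≤ ∫ x, 2 * ‖(starRingEnd ℂ) (w x) - g x‖ ∂m := by
          refine integral_mono_ae (hcw.sub hhw).norm
            ((hv.sub (integrable_continuousMap g)).norm.const_mul 2) ?_
          filter_upwards [hw1] with x hx
          rw [← sub_mul, norm_mul, hx, mul_one]
          exact norm_sub_clip_le (g x) _ (by simpa using hx)
      _ = 2 * ∫ x, ‖(starRingEnd ℂ) (w x) - g x‖ ∂m := integral_const_mul _ _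
      _ ≤ ε := by linarith
  calc ‖μ‖ = ‖((‖μ‖ : ℝ) : ℂ)‖ := by simp
    _ = ‖toDual μ h + (((‖μ‖ : ℝ) : ℂ) - toDual μ h)‖ := by rw [add_sub_cancel]
    _ ≤ ‖toDual μ h‖ + ε := (norm_add_le _ _).trans (by gcongr)
    _ ≤ ‖toDual μ‖ * ‖h‖ + ε := by gcongr; exact (toDual μ).le_opNorm h
    _ ≤ ‖toDual μ‖ + ε := by
      gcongr
      exact mul_le_of_le_one_right (norm_nonneg _) hh

/-- On real functions, the real and imaginary parts of `φ` are differences of positive measures;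
complex linearity recovers `φ` from its values there. -/
theorem toDual_surjective : Function.Surjective (toDual (K := K)) := by
  intro φ
  let j : C(K, ℝ) →ₗ[ℝ] C(K, ℂ) :=
    { toFun := fun f => ⟨fun x => (f x : ℂ), by fun_prop⟩
      map_add' := fun f g => by ext x; simp
      map_smul' := fun c f => by ext x; simp }
  have hj : ∀ f, ‖j f‖ ≤ ‖f‖ := fun f =>
    (ContinuousMap.norm_le _ (norm_nonneg _)).2 fun x => by
      change ‖((f x : ℝ) : ℂ)‖ ≤ ‖f‖
      rw [Complex.norm_real]; exact f.norm_coe_le_norm x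
  have hφ : ∀ f, ‖φ (j f)‖ ≤ ‖φ‖ * ‖f‖ := fun f =>
    (φ.le_opNorm _).trans (mul_le_mul_of_nonneg_left (hj f) (norm_nonneg _))
  obtain ⟨a₁, a₂, i₁, i₂, ha⟩ := exists_measure_sub_of_real_functional
    (φ := Complex.reLm ∘ₗ φ.toLinearMap.restrictScalars ℝ ∘ₗ j) (C := ‖φ‖)
    (fun f => (Complex.abs_re_le_norm _).trans (hφ f)) (norm_nonneg _)
  obtain ⟨b₁, b₂, k₁, k₂, hb⟩ := exists_measure_sub_of_real_functional
    (φ := Complex.imLm ∘ₗ φ.toLinearMap.restrictScalars ℝ ∘ₗ j) (C := ‖φ‖)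
    (fun f => (Complex.abs_im_le_norm _).trans (hφ f)) (norm_nonneg _)
  let c : Measure K → ComplexMeasure K := fun m => m.withDensityᵥ fun _ => (1 : ℂ)
  have hc : ∀ (m : Measure K) [IsFiniteMeasure m] (f : C(K, ℝ)),
      toDual (c m) (j f) = ((∫ x, f x ∂m : ℝ) : ℂ) := fun m _ f => by
    rw [toDual_withDensityᵥ (integrable_const 1)]
    simp only [mul_one]
    exact integral_ofReal
  obtain ⟨μ, hμ⟩ : ∃ μ, ∀ f, toDual μ (j f) = φ (j f) := by
    refine ⟨(c a₁ - c a₂) + Complex.I • (c b₁ - c b₂), fun f => ?_⟩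
    have e1 := ha f
    have e2 := hb f
    simp only [LinearMap.comp_apply] at e1 e2
    rw [map_add, map_smul, map_sub, map_sub, add_apply, smul_apply, sub_apply, sub_apply, hc, hc, hc, hc,
      ← Complex.ofReal_sub, ← Complex.ofReal_sub, ← e1, ← e2, smul_eq_mul, mul_comm]
    exact Complex.re_add_im _
  refine ⟨μ, ?_⟩
  ext f
  have e : f = j ⟨fun x => (f x).re, by fun_prop⟩ +
      Complex.I • j ⟨fun x => (f x).im, by fun_prop⟩ := by
    ext x
    change f x = ((f x).re : ℂ) + Complex.I * ((f x).im : ℂ)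
    rw [mul_comm]; exact (Complex.re_add_im _).symm
  rw [e, map_add, map_smul, map_add, map_smul, hμ, hμ]

end Riesz

/-! ### Separability lemmas and adjoints of weakly compact operators -/

section WeaklyCompact

/-- With the pseudometric pulled back along `b`, the index type is second countable and `a` is
`1`-Lipschitz. -/
theorem isSeparable_range_of_dist_le {V Y Z : Type*} [PseudoMetricSpace Y] [PseudoMetricSpace Z]
    [SecondCountableTopology Z] {a : V → Y} {b : V → Z}
    (h : ∀ v w, dist (a v) (a w) ≤ dist (b v) (b w)) : IsSeparable (Set.range a) := by
  let : PseudoMetricSpace V := PseudoMetricSpace.induced b inferInstance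
  have hb : IsInducing b := ⟨rfl⟩
  have : SecondCountableTopology V := hb.secondCountableTopology
  have ha : LipschitzWith 1 a := LipschitzWith.of_dist_le_mul fun v w => by
    rw [NNReal.coe_one, one_mul]; exact h v w
  exact isSeparable_range ha.continuous

theorem exists_countable_of_isSeparable_image {V Y : Type*} [PseudoMetricSpace Y] {f : V → Y}
    {B : Set V} (h : IsSeparable (f '' B)) :
    ∃ D ⊆ B, D.Countable ∧ ∀ b ∈ B, ∀ ε > 0, ∃ d ∈ D, dist (f b) (f d) < ε := by
  have := h.separableSpace
  obtain ⟨D, hDc, hD⟩ := exists_countable_dense (f '' B)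
  choose d hdB hd using fun y : f '' B => y.2
  refine ⟨d '' D, ?_, hDc.image d, fun b hb ε hε => ?_⟩
  · rintro _ ⟨y, -, rfl⟩
    exact hdB y
  · obtain ⟨y, hyD, hy⟩ := hD.exists_dist_lt ⟨f b, b, hb, rfl⟩ hε
    refine ⟨d y, ⟨y, hyD, rfl⟩, ?_⟩
    rw [hd]
    exact hy

/-- Precomposition with a bounded operator, that is, its adjoint. -/
def precomp {E F : Type*} [NormedAddCommGroup E] [NormedSpace ℂ E] [SeminormedAddCommGroup F]
    [NormedSpace ℂ F] (T : E →L[ℂ] F) : StrongDual ℂ F →L[ℂ] StrongDual ℂ E :=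
  (ContinuousLinearMap.compL ℂ E F ℂ).flip T

theorem precomp_apply {E F : Type*} [NormedAddCommGroup E] [NormedSpace ℂ E]
    [SeminormedAddCommGroup F] [NormedSpace ℂ F] (T : E →L[ℂ] F) (φ : StrongDual ℂ F) (x : E) :
    precomp T φ x = φ (T x) := rfl

theorem isSeparable_image_topologicalClosure_span {V Y : Type*} [NormedAddCommGroup V]
    [NormedSpace ℂ V] [NormedAddCommGroup Y] [NormedSpace ℂ Y] (r : V →L[ℂ] Y) {S : Set V}
    (hS : IsSeparable (r '' S)) :
    IsSeparable (r '' ((Submodule.span ℂ S).topologicalClosure : Set V)) := by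
  refine (hS.span (R := ℂ)).closure.mono ?_
  rintro _ ⟨φ, hφ, rfl⟩
  refine map_mem_closure (f := r) r.continuous hφ fun ψ hψ => ?_
  have h2 : r ψ ∈ (Submodule.span ℂ S).map r.toLinearMap := ⟨ψ, hψ, rfl⟩
  rw [Submodule.map_span] at h2
  exact h2

theorem mapsTo_topologicalClosure_span {V : Type*} [NormedAddCommGroup V] [NormedSpace ℂ V]
    (L : V →L[ℂ] V) {S : Set V} (h : Set.MapsTo L S S) :
    Set.MapsTo L ((Submodule.span ℂ S).topologicalClosure : Set V)
      ((Submodule.span ℂ S).topologicalClosure : Set V) := by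
  have h1 : Submodule.span ℂ S ≤
      (Submodule.span ℂ S).topologicalClosure.comap L.toLinearMap :=
    Submodule.span_le.2 fun φ hφ =>
      Submodule.le_topologicalClosure _ (Submodule.subset_span (h hφ))
  exact fun φ hφ => Submodule.topologicalClosure_minimal _ h1
    ((Submodule.isClosed_topologicalClosure _).preimage L.continuous) hφ

theorem isSeparable_image_of_denseRange {Z Y : Type*} [TopologicalSpace Z] [PseudoMetricSpace Y]
    {ι : Type*} (f : ι → Z → Y) (hf : ∀ i, Continuous (f i)) {u : ℕ → Z} (hu : DenseRange u)
    (h : ∀ n, IsSeparable (Set.range fun i => f i (u n))) :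
    IsSeparable (⋃ i, Set.range (f i)) := by
  refine (IsSeparable.iUnion h).closure.mono (Set.iUnion_subset fun i => ?_)
  rintro _ ⟨z, rfl⟩
  refine map_mem_closure (hf i) (hu z) ?_
  rintro _ ⟨n, rfl⟩
  exact Set.mem_iUnion.2 ⟨n, i, rfl⟩

/-- The dual of a separable seminormed space contains a sequence separating points. -/
theorem exists_seq_dual_separating (F : Type*) [SeminormedAddCommGroup F] [NormedSpace ℂ F]
    [SeparableSpace F] :
    ∃ φ : ℕ → StrongDual ℂ F, ∀ x, (∀ n, φ n x = 0) → ‖x‖ = 0 := by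
  choose φ hφ1 hφ2 using fun n => exists_dual_vector'' ℂ (denseSeq F n)
  refine ⟨φ, fun x hx => (norm_nonneg x).antisymm' (le_of_forall_pos_le_add fun ε hε => ?_)⟩
  obtain ⟨n, hn⟩ := (denseRange_denseSeq F).exists_dist_lt x (half_pos hε)
  -- `φ n` norms the `n`th point of the dense sequence and kills `x`, so it takes the value
  -- `-‖denseSeq F n‖` at the difference.
  have h1 : ‖denseSeq F n‖ ≤ ‖x - denseSeq F n‖ := by
    have h2 : φ n (x - denseSeq F n) = -(‖denseSeq F n‖ : ℂ) := by
      rw [map_sub, hx n, hφ2 n, zero_sub]; rfl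
    calc ‖denseSeq F n‖ = ‖φ n (x - denseSeq F n)‖ := by rw [h2, norm_neg]; simp
      _ ≤ ‖φ n‖ * ‖x - denseSeq F n‖ := (φ n).le_opNorm _
      _ ≤ ‖x - denseSeq F n‖ := mul_le_of_le_one_left (norm_nonneg _) (hφ1 n)
  have h3 : ‖x‖ ≤ ‖x - denseSeq F n‖ + ‖denseSeq F n‖ := by
    simpa using norm_add_le (x - denseSeq F n) (denseSeq F n)
  rw [dist_eq_norm] at hn
  linarith

/-- The adjoint of a weakly compact operator into a separable space has separable range. -/
theorem IsWeaklyCompactOperator.isSeparable_range_adjoint {E F : Type*} [NormedAddCommGroup E]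
    [NormedSpace ℂ E] [SeminormedAddCommGroup F] [NormedSpace ℂ F] [SeparableSpace F]
    (hF : ∀ x : F, ‖x‖ = 0 → x = 0) {T : E →L[ℂ] F} (hT : IsWeaklyCompactOperator T) :
    IsSeparable (Set.range (precomp T)) := by
  unfold IsWeaklyCompactOperator at hT
  set W : Set (WeakSpace ℂ F) := closure (toWeakSpace ℂ F '' (T '' Metric.closedBall 0 1)) with hW
  have : CompactSpace W := isCompact_iff_compactSpace.1 hT
  have hcont : ∀ φ : StrongDual ℂ F,
      Continuous fun x : WeakSpace ℂ F => φ ((toWeakSpace ℂ F).symm x) := fun φ =>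
    WeakBilin.eval_continuous (topDualPairing ℂ F).flip φ
  obtain ⟨φ, hφ⟩ := exists_seq_dual_separating F
  -- Countably many functionals separate the points of the compact set `W`, so `e` embeds it in
  -- `ℂ^ℕ`. Hence `W` is second countable, and so is `C(W, ℂ)`.
  let e : W → ℕ → ℂ := fun x n => φ n ((toWeakSpace ℂ F).symm x)
  have he : Continuous e :=
    continuous_pi fun n => (hcont (φ n)).comp continuous_subtype_val
  have hinj : Function.Injective e := by
    intro x y hxy
    apply Subtype.ext
    apply (toWeakSpace ℂ F).symm.injective
    rw [← sub_eq_zero]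
    refine hF _ (hφ _ fun n => ?_)
    rw [map_sub, sub_eq_zero]
    exact congrFun hxy n
  have hemb : IsEmbedding e := (he.isClosedEmbedding hinj).isEmbedding
  have : T2Space W := hemb.t2Space
  have : SecondCountableTopology W := hemb.secondCountableTopology
  let J : StrongDual ℂ F → C(W, ℂ) := fun ψ =>
    ⟨fun x => ψ ((toWeakSpace ℂ F).symm x), (hcont ψ).comp continuous_subtype_val⟩
  -- `T` maps the unit ball into `W`, so the norm of a difference of adjoint images is bounded by
  -- the supremum over `W`.
  refine isSeparable_range_of_dist_le (b := J) fun ψ χ => ?_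
  rw [dist_eq_norm, dist_eq_norm]
  refine ContinuousLinearMap.opNorm_le_of_unit_norm (norm_nonneg _) fun x hx => ?_
  have hmem : toWeakSpace ℂ F (T x) ∈ W :=
    subset_closure ⟨T x, ⟨x, by simp [hx], rfl⟩, rfl⟩
  exact (J ψ - J χ).norm_coe_le_norm ⟨_, hmem⟩

end WeaklyCompact

/-! ### The generated band restricts to a separable subset of `X^*` -/

section Bands

variable {K : Type*} [MetricSpace K] [CompactSpace K]

/-- The action of `C(K)` on its dual: `(φ g)(f) = φ (f g)`. -/
def mulDual (g : C(K, ℂ)) : StrongDual ℂ C(K, ℂ) →L[ℂ] StrongDual ℂ C(K, ℂ) :=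
  precomp ((ContinuousLinearMap.mul ℂ C(K, ℂ)).flip g)

theorem mulDual_apply (g f : C(K, ℂ)) (φ : StrongDual ℂ C(K, ℂ)) :
    mulDual g φ f = φ (f * g) := rfl

theorem mulDual_one (φ : StrongDual ℂ C(K, ℂ)) : mulDual 1 φ = φ := by
  ext f; rw [mulDual_apply, mul_one]

theorem mulDual_mulDual (g h : C(K, ℂ)) (φ : StrongDual ℂ C(K, ℂ)) :
    mulDual g (mulDual h φ) = mulDual (g * h) φ := by
  ext f; rw [mulDual_apply, mulDual_apply, mulDual_apply, mul_assoc]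

theorem continuous_mulDual (φ : StrongDual ℂ C(K, ℂ)) : Continuous fun g => mulDual g φ :=
  (ContinuousLinearMap.compL ℂ C(K, ℂ) C(K, ℂ) ℂ φ).continuous.comp
    (ContinuousLinearMap.mul ℂ C(K, ℂ)).flip.continuous

theorem IsTight.isSeparable_range_adjoint_hankelOperator {X : Submodule ℂ C(K, ℂ)}
    (hX : IsTight X) (g : C(K, ℂ)) : IsSeparable (Set.range (precomp (hankelOperator X g))) := by
  have hF : ∀ x : C(K, ℂ) ⧸ X, ‖x‖ = 0 → x = 0 := fun x hx => by
    obtain ⟨f, rfl⟩ := Submodule.Quotient.mk_surjective X x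
    rw [Submodule.Quotient.mk_eq_zero]
    exact hX.1.closure_subset
      ((QuotientAddGroup.norm_mk_eq_zero_iff_mem_closure (S := X.toAddSubgroup)).1 hx)
  have : SeparableSpace (C(K, ℂ) ⧸ X) :=
    (Submodule.Quotient.mk_surjective X).denseRange.separableSpace X.mkQL.continuous
  exact IsWeaklyCompactOperator.isSeparable_range_adjoint hF (hX.2 g)

variable [MeasurableSpace K] [BorelSpace K]

/-- The restriction of a measure, as a functional on `C(K)`, to a subspace `X`. -/
def restrictDual (X : Submodule ℂ C(K, ℂ)) : ComplexMeasure K →ₗ[ℂ] StrongDual ℂ X :=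
  (precomp X.subtypeL).toLinearMap ∘ₗ toDual

theorem restrictDual_apply (X : Submodule ℂ C(K, ℂ)) (μ : ComplexMeasure K) (f : X) :
    restrictDual X μ f = toDual μ f := rfl

theorem mem_annihilator_iff {X : Submodule ℂ C(K, ℂ)} {μ : ComplexMeasure K} :
    μ ∈ annihilator X ↔ restrictDual X μ = 0 := by
  constructor
  · intro h; ext f; exact h f f.2
  · intro h f hf; exact DFunLike.congr_fun h (⟨f, hf⟩ : X)

theorem exists_restrictDual_eq (X : Submodule ℂ C(K, ℂ)) (ψ : StrongDual ℂ X) :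
    ∃ μ, restrictDual X μ = ψ ∧ ‖μ‖ = ‖ψ‖ := by
  obtain ⟨g, hg, hn⟩ := exists_extension_norm_eq X ψ
  obtain ⟨μ, rfl⟩ := toDual_surjective g
  exact ⟨μ, by ext f; exact hg f, by rw [← hn, norm_toDual]⟩

/-- A norm-preserving Hahn–Banach extension of the restriction of `μ` differs from `μ` by an
annihilating measure. Thus the quotient norm modulo `X^⊥` is the norm in `X^*`, and it is attained.
-/
theorem exists_annihilator_norm_add_eq (X : Submodule ℂ C(K, ℂ)) (μ : ComplexMeasure K) :
    ∃ ν ∈ annihilator X, ‖μ + ν‖ = ‖restrictDual X μ‖ := by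
  obtain ⟨κ, h1, h2⟩ := exists_restrictDual_eq X (restrictDual X μ)
  refine ⟨κ - μ, ?_, by rw [add_sub_cancel, h2]⟩
  rw [mem_annihilator_iff, map_sub, h1, sub_self]

theorem norm_restrictDual_le (X : Submodule ℂ C(K, ℂ)) (μ : ComplexMeasure K) :
    ‖restrictDual X μ‖ ≤ ‖μ‖ :=
  ContinuousLinearMap.opNorm_le_bound _ (norm_nonneg _) fun f => by
    rw [← norm_toDual μ, restrictDual_apply]; exact (toDual μ).le_opNorm (f : C(K, ℂ))

/-- A closed space of functionals invariant under multiplication by continuous functions is a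
band. -/
theorem isBand_comap_toDual {N : Submodule ℂ (StrongDual ℂ C(K, ℂ))}
    (hN : IsClosed (N : Set (StrongDual ℂ C(K, ℂ)))) (hmul : ∀ g, ∀ φ ∈ N, mulDual g φ ∈ N) :
    IsBand (N.comap (toDual (K := K))) := by
  have hcont : Continuous (toDual (K := K)) :=
    (AddMonoidHomClass.isometry_of_norm _ norm_toDual).continuous
  refine ⟨hN.preimage hcont, fun μ hμ ν hν => ?_⟩
  obtain ⟨w, hw, hμw, hw1⟩ := exists_unimodular_density μ
  obtain ⟨v, hv, rfl⟩ := exists_eq_withDensityᵥ ν μ.variation hν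
  set m := μ.variation with hm
  -- Since `|w| = 1`, `ν` has density `v * conj w` relative to `μ` itself. If a continuous `g` is
  -- close to this density in `L¹(|μ|)`, then `gμ` is close to `ν` in norm.
  have hvw : Integrable (fun x => v x * (starRingEnd ℂ) (w x)) m := by
    refine hv.mul_bdd (c := 1)
      (Complex.continuous_conj.comp_aestronglyMeasurable hw.aestronglyMeasurable) ?_
    filter_upwards [hw1] with x hx
    simp [hx]
  refine hN.closure_subset (Metric.mem_closure_iff.2 fun ε hε => ?_)
  obtain ⟨g, hg⟩ := exists_continuousMap_integral_norm_sub_le hvw (half_pos hε)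
  have hgw : Integrable (fun x => g x * w x) m :=
    hw.bdd_mul g.continuous.stronglyMeasurable.aestronglyMeasurable (c := ‖g‖)
      (Eventually.of_forall g.norm_coe_le_norm)
  have e1 : mulDual g (toDual μ) = toDual (m.withDensityᵥ fun x => g x * w x) := by
    ext f
    rw [mulDual_apply, toDual_withDensityᵥ hgw]
    conv_lhs => rw [hμw]
    rw [toDual_withDensityᵥ hw]
    simp only [ContinuousMap.mul_apply, mul_assoc]
  refine ⟨mulDual g (toDual μ), hmul g _ hμ, ?_⟩
  rw [e1, dist_eq_norm, ← map_sub, norm_toDual, ← withDensityᵥ_sub hv hgw,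
    norm_withDensityᵥ (hv.sub hgw)]
  calc ∫ x, ‖v x - g x * w x‖ ∂m = ∫ x, ‖v x * (starRingEnd ℂ) (w x) - g x‖ ∂m := by
        refine integral_congr_ae ?_
        filter_upwards [hw1] with x hx
        have h1 : (starRingEnd ℂ) (w x) * w x = 1 := by rw [Complex.conj_mul', hx]; simp
        have h2 : v x - g x * w x = (v x * (starRingEnd ℂ) (w x) - g x) * w x := by
          rw [sub_mul, mul_assoc, h1, mul_one]
        rw [h2, norm_mul, hx, mul_one]
    _ ≤ ε / 2 := hg
    _ < ε := half_lt_self hε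

/-- As `μ` annihilates `X`, it descends to a functional on `C(K)/X`, and the adjoint of `S_g` sends
this functional to `f ↦ ∫ f g dμ`. -/
theorem mulDual_toDual_mem_range_adjoint {X : Submodule ℂ C(K, ℂ)} (g : C(K, ℂ))
    {μ : ComplexMeasure K} (hμ : μ ∈ annihilator X) :
    precomp X.subtypeL (mulDual g (toDual μ)) ∈ Set.range (precomp (hankelOperator X g)) := by
  refine ⟨X.liftQL (toDual μ) fun f hf => hμ f hf, ?_⟩
  ext f
  rw [precomp_apply, hankelOperator_apply, precomp_apply, mulDual_apply]
  rfl

theorem range_mulDual_subset_range_adjoint (X : Submodule ℂ C(K, ℂ)) (g : C(K, ℂ)) :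
    (Set.range fun μ : annihilator X => precomp X.subtypeL (mulDual g (toDual μ.1))) ⊆
      Set.range (precomp (hankelOperator X g)) :=
  Set.range_subset_iff.2 fun μ => mulDual_toDual_mem_range_adjoint g μ.2

theorem isSeparable_range_mulDual {X : Submodule ℂ C(K, ℂ)} (hX : IsTight X) (g : C(K, ℂ)) :
    IsSeparable (Set.range fun μ : annihilator X =>
      precomp X.subtypeL (mulDual g (toDual μ.1))) := by
  have h := hX.isSeparable_range_adjoint_hankelOperator g
  exact IsSeparable.mono h (range_mulDual_subset_range_adjoint X g)

theorem mulDual_mem_topologicalClosure_span (A : Set (ComplexMeasure K)) (g : C(K, ℂ))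
    {φ : StrongDual ℂ C(K, ℂ)}
    (hφ : φ ∈ (Submodule.span ℂ (⋃ μ : A, Set.range fun g =>
      mulDual g (toDual μ.1))).topologicalClosure) :
    mulDual g φ ∈ (Submodule.span ℂ (⋃ μ : A, Set.range fun g =>
      mulDual g (toDual μ.1))).topologicalClosure := by
  refine mapsTo_topologicalClosure_span (V := StrongDual ℂ C(K, ℂ)) (mulDual g) ?_ hφ
  rintro φ hφ
  obtain ⟨μ, h, rfl⟩ := Set.mem_iUnion.1 hφ
  exact Set.mem_iUnion.2 ⟨μ, g * h, (mulDual_mulDual g h _).symm⟩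

/-- The right side is a band, being the preimage of a closed space invariant under multiplication by
`C(K)`, and it contains `A` because `g = 1` is allowed. -/
theorem generatedBand_le_comap_topologicalClosure_span (A : Set (ComplexMeasure K)) :
    generatedBand A ≤ (Submodule.span ℂ (⋃ μ : A, Set.range fun g =>
      mulDual g (toDual μ.1))).topologicalClosure.comap toDual := by
  refine sInf_le ⟨isBand_comap_toDual (Submodule.isClosed_topologicalClosure _)
    fun g φ hφ => mulDual_mem_topologicalClosure_span A g hφ, fun μ hμ => ?_⟩
  exact Submodule.le_topologicalClosure _
    (Submodule.subset_span (Set.mem_iUnion.2 ⟨⟨μ, hμ⟩, 1, mulDual_one _⟩))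

theorem isSeparable_image_generatedBand {Y : Type*} [NormedAddCommGroup Y] [NormedSpace ℂ Y]
    (r : StrongDual ℂ C(K, ℂ) →L[ℂ] Y) (A : Set (ComplexMeasure K))
    (h : ∀ g, IsSeparable (Set.range fun μ : A => r (mulDual g (toDual μ.1)))) :
    IsSeparable ((fun μ => r (toDual μ)) '' (generatedBand A : Set (ComplexMeasure K))) := by
  have hS : IsSeparable (r '' ⋃ μ : A, Set.range fun g => mulDual g (toDual μ.1)) := by
    have h1 := isSeparable_image_of_denseRange
      (fun (μ : A) g => r (mulDual g (toDual μ.1)))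
      (fun μ => r.continuous.comp (continuous_mulDual _))
      (denseRange_denseSeq C(K, ℂ)) (fun n => h _)
    refine h1.mono ?_
    rw [Set.image_iUnion]
    refine Set.iUnion_mono fun μ => ?_
    rw [← Set.range_comp]
    exact subset_rfl
  refine (isSeparable_image_topologicalClosure_span (V := StrongDual ℂ C(K, ℂ)) r hS).mono ?_
  rintro _ ⟨μ, hμ, rfl⟩
  exact ⟨toDual μ, generatedBand_le_comap_topologicalClosure_span A hμ, rfl⟩

theorem isSeparable_restrictDual_image {X : Submodule ℂ C(K, ℂ)} (hX : IsTight X) :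
    IsSeparable (restrictDual X '' generatedBand (annihilator X : Set (ComplexMeasure K))) :=
  isSeparable_image_generatedBand (precomp X.subtypeL) (annihilator X : Set (ComplexMeasure K))
    fun g => isSeparable_range_mulDual hX g

theorem separableSpace_quotient {X : Submodule ℂ C(K, ℂ)} {B : Submodule ℂ (ComplexMeasure K)}
    (hXB : annihilator X ≤ B) (hB : IsSeparable (restrictDual X '' B)) :
    SeparableSpace (B ⧸ (annihilator X).submoduleOf B) := by
  obtain ⟨D, hDB, hDc, hD⟩ := exists_countable_of_isSeparable_image (Y := StrongDual ℂ X) hB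
  let q : B → B ⧸ (annihilator X).submoduleOf B := Submodule.Quotient.mk
  have hcont : Continuous q := continuous_quotient_mk'
  refine ⟨q '' (Subtype.val ⁻¹' D), (hDc.preimage Subtype.val_injective).image q, fun z => ?_⟩
  obtain ⟨b, rfl⟩ := Submodule.Quotient.mk_surjective _ z
  refine mem_closure_iff.2 fun U hU hbU => ?_
  obtain ⟨ε, hε, hball⟩ := Metric.isOpen_iff.1 (hU.preimage hcont) b hbU
  obtain ⟨d, hdD, hd⟩ := hD b b.2 ε hε
  -- The measures `d` and `b` are close only as functionals on `X`. The correction `ν` makes `d + ν`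
  -- close to `b` in variation norm and leaves the class of `d` unchanged; `ν ∈ B` because `X^⊥ ⊆
  -- B`.
  obtain ⟨ν, hν, hn⟩ := exists_annihilator_norm_add_eq X (d - b)
  have hνB : (⟨ν, hXB hν⟩ : B) ∈ (annihilator X).submoduleOf B := hν
  have hin : (⟨d, hDB hdD⟩ + ⟨ν, hXB hν⟩ : B) ∈ Metric.ball b ε := by
    rw [mem_ball_iff_norm]
    change ‖d + ν - b‖ < ε
    rw [show d + ν - b = d - b + ν by abel, hn, map_sub]
    exact (dist_eq_norm (restrictDual X d) _).symm.trans_lt ((dist_comm _ _).trans_lt hd)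
  refine ⟨q ⟨d, hDB hdD⟩, ?_, ⟨d, hDB hdD⟩, hdD, rfl⟩
  have h1 := hball hin
  rw [Set.mem_preimage] at h1
  have h2 : q (⟨d, hDB hdD⟩ + ⟨ν, hXB hν⟩) = q ⟨d, hDB hdD⟩ := by
    refine (Submodule.Quotient.eq _).2 ?_
    rwa [add_sub_cancel_left]
  rwa [h2] at h1

end Bands

/-! ### Lebesgue decomposition with respect to a band -/

section BandDecomposition

variable {K : Type*} [MeasurableSpace K]

theorem norm_restrict (ν : ComplexMeasure K) {s : Set K} (hs : MeasurableSet s) :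
    ‖(ν.restrict s : ComplexMeasure K)‖ = ν.variation.real s := by
  rw [norm_eq_variation, VectorMeasure.variation_restrict hs, measureReal_restrict_apply_univ]

theorem IsBand.restrict_mem_of_subset {B : Submodule ℂ (ComplexMeasure K)} (hB : IsBand B)
    {ν : ComplexMeasure K} {s t : Set K} (hs : MeasurableSet s) (ht : MeasurableSet t)
    (hst : s ⊆ t) (h : ν.restrict t ∈ B) : ν.restrict s ∈ B := by
  refine hB.2 _ h _ ?_
  rw [VectorMeasure.variation_restrict hs, VectorMeasure.variation_restrict ht]
  exact (Measure.restrict_mono hst le_rfl).absolutelyContinuous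

theorem IsBand.restrict_union_mem {B : Submodule ℂ (ComplexMeasure K)} (hB : IsBand B)
    {ν : ComplexMeasure K} {s t : Set K} (hs : MeasurableSet s) (ht : MeasurableSet t)
    (h1 : ν.restrict s ∈ B) (h2 : ν.restrict t ∈ B) : ν.restrict (s ∪ t) ∈ B := by
  rw [← Set.union_sdiff_self, VectorMeasure.restrict_union Set.disjoint_sdiff_right hs (ht.diff hs)]
  exact B.add_mem h1 (hB.restrict_mem_of_subset (ht.diff hs) ht Set.sdiff_subset h2)

/-- Restrictions to the finite unions stay in `B` and converge in variation norm, by continuity of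
`|ν|` from below; `B` is closed. -/
theorem IsBand.restrict_iUnion_mem {B : Submodule ℂ (ComplexMeasure K)} (hB : IsBand B)
    {ν : ComplexMeasure K} {s : ℕ → Set K} (hs : ∀ n, MeasurableSet (s n))
    (h : ∀ n, ν.restrict (s n) ∈ B) : ν.restrict (⋃ n, s n) ∈ B := by
  have hm : ∀ n, MeasurableSet (Set.accumulate s n) := fun n =>
    MeasurableSet.biUnion (Set.to_countable _) fun i _ => hs i
  have hacc : ∀ n, ν.restrict (Set.accumulate s n) ∈ B := by
    intro n
    induction n with
    | zero => rw [Set.accumulate_zero_nat]; exact h 0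
    | succ n ih =>
      rw [Set.accumulate_succ]
      exact hB.restrict_union_mem (hm n) (hs _) ih (h _)
  refine hB.1.mem_of_tendsto (f := fun n => (ν.restrict (Set.accumulate s n) : ComplexMeasure K))
    (b := atTop) ?_ (Eventually.of_forall hacc)
  rw [tendsto_iff_norm_sub_tendsto_zero]
  have hU : MeasurableSet (⋃ n, s n) := MeasurableSet.iUnion hs
  have hsub : ∀ n, Set.accumulate s n ⊆ ⋃ n, s n := fun n =>
    Set.iUnion₂_subset fun i _ => Set.subset_iUnion s i
  have e : ∀ n, ‖(ν.restrict (Set.accumulate s n) - ν.restrict (⋃ n, s n) : ComplexMeasure K)‖ =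
      ν.variation.real (⋃ n, s n) - ν.variation.real (Set.accumulate s n) := fun n => by
    have h1 : ν.restrict (⋃ n, s n) = ν.restrict (Set.accumulate s n) +
        ν.restrict ((⋃ n, s n) \ Set.accumulate s n) := by
      rw [← VectorMeasure.restrict_union Set.disjoint_sdiff_right (hm n) (hU.diff (hm n)),
        Set.union_sdiff_cancel (hsub n)]
    rw [h1, norm_sub_rev, add_sub_cancel_left, norm_restrict _ (hU.diff (hm n)),
      measureReal_sdiff (hsub n) (hm n)]
  simp only [e]
  have ht : Tendsto (fun n => ν.variation.real (Set.accumulate s n)) atTop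
      (𝓝 (ν.variation.real (⋃ n, s n))) :=
    (ENNReal.tendsto_toReal (measure_ne_top _ _)).comp tendsto_measure_iUnion_accumulate
  simpa using ht.const_sub (ν.variation.real (⋃ n, s n))

/-- There is a largest set, up to null sets, on which `ν` belongs to a given band. -/
theorem IsBand.exists_maximal_restrict_mem {B : Submodule ℂ (ComplexMeasure K)} (hB : IsBand B)
    (ν : ComplexMeasure K) :
    ∃ t, MeasurableSet t ∧ ν.restrict t ∈ B ∧
      ∀ s, MeasurableSet s → ν.restrict s ∈ B → ν.variation (s \ t) = 0 := by
  set C : Set (Set K) := {s | MeasurableSet s ∧ ν.restrict s ∈ B} with hC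
  have hne : (ν.variation '' C).Nonempty :=
    ⟨_, ∅, ⟨MeasurableSet.empty, by rw [VectorMeasure.restrict_empty]; exact B.zero_mem⟩, rfl⟩
  -- Exhaustion: the union of a sequence of admissible sets whose `|ν|`-masses tend to the supremum
  -- is admissible and attains it.
  obtain ⟨a, -, ha, hmem⟩ := exists_seq_tendsto_sSup hne (OrderTop.bddAbove _)
  choose s hsC hs using hmem
  have htC : (⋃ n, s n) ∈ C :=
    ⟨MeasurableSet.iUnion fun n => (hsC n).1,
      hB.restrict_iUnion_mem (fun n => (hsC n).1) fun n => (hsC n).2⟩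
  refine ⟨⋃ n, s n, htC.1, htC.2, fun r hr hrB => ?_⟩
  have h1 : ν.variation ((⋃ n, s n) ∪ r) ≤ ν.variation (⋃ n, s n) := by
    have hmem : (⋃ n, s n) ∪ r ∈ C :=
      ⟨htC.1.union hr, hB.restrict_union_mem htC.1 hr htC.2 hrB⟩
    refine (le_sSup (Set.mem_image_of_mem _ hmem)).trans ?_
    refine le_of_tendsto' ha fun n => ?_
    rw [← hs n]
    exact measure_mono (Set.subset_iUnion s n)
  rw [← Set.union_sdiff_self, measure_union Set.disjoint_sdiff_right (hr.diff htC.1)] at h1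
  exact le_zero_iff.1 ((ENNReal.add_le_add_iff_left (measure_ne_top ν.variation (⋃ n, s n))).1
    (h1.trans_eq (add_zero _).symm))

/-- Take `s` carrying `l` and null for the singular part of `m`; on `s` only the absolutely
continuous part of `m` survives. -/
theorem exists_measurableSet_restrict_absolutelyContinuous (m l : Measure K) [IsFiniteMeasure m]
    [IsFiniteMeasure l] : ∃ s, MeasurableSet s ∧ l sᶜ = 0 ∧ m.restrict s ≪ l := by
  obtain ⟨s, hs, h1, h2⟩ := m.mutuallySingular_singularPart l
  refine ⟨s, hs, h2, Measure.AbsolutelyContinuous.mk fun t ht h0 => ?_⟩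
  rw [Measure.restrict_apply ht, m.haveLebesgueDecomposition_add l, Measure.add_apply,
    measure_mono_null Set.inter_subset_right h1, zero_add]
  exact withDensity_absolutelyContinuous l _ (measure_mono_null Set.inter_subset_left h0)

/-- Lebesgue decomposition of a measure with respect to a band. -/
theorem IsBand.exists_decomposition {B : Submodule ℂ (ComplexMeasure K)} (hB : IsBand B)
    (ν : ComplexMeasure K) :
    ∃ β ∈ B, ∃ σ : ComplexMeasure K, ν = β + σ ∧ σ.variation ≤ ν.variation ∧
      ∀ μ ∈ B, σ.variation ⟂ₘ μ.variation := by
  obtain ⟨t, ht, htB, hmax⟩ := hB.exists_maximal_restrict_mem ν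
  refine ⟨ν.restrict t, htB, ν.restrict tᶜ, ?_, ?_, fun μ hμ => ?_⟩
  · exact (VectorMeasure.restrict_add_restrict_compl ht).symm
  · rw [VectorMeasure.variation_restrict ht.compl]; exact Measure.restrict_le_self
  · rw [VectorMeasure.variation_restrict ht.compl]
    obtain ⟨s, hs, h1, h2⟩ :=
      exists_measurableSet_restrict_absolutelyContinuous (ν.variation.restrict tᶜ) μ.variation
    rw [Measure.restrict_restrict hs] at h2
    -- The part of `ν` outside `t` that is absolutely continuous with respect to `μ ∈ B` lies in
    -- `B`, so maximality of `t` makes it null.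
    have h3 : ν.restrict (s ∩ tᶜ) ∈ B := by
      refine hB.2 μ hμ _ ?_
      rwa [VectorMeasure.variation_restrict (hs.inter ht.compl)]
    have h4 := hmax _ (hs.inter ht.compl) h3
    refine ⟨s, hs, ?_, h1⟩
    rw [Measure.restrict_apply hs]
    refine measure_mono_null (fun x hx => ?_) h4
    exact ⟨hx, hx.2⟩

/-- In a family maximal by Zorn's lemma, a further measure with `P` singular to all members is
already a member, hence singular to itself and zero. -/
theorem exists_maximal_mutuallySingular (P : Measure K → Prop) :
    ∃ S : Set (Measure K), (∀ m ∈ S, P m) ∧ S.Pairwise Measure.MutuallySingular ∧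
      ∀ m, P m → (∀ l ∈ S, m ⟂ₘ l) → m = 0 := by
  obtain ⟨S, hS⟩ := zorn_subset
    {S : Set (Measure K) | (∀ m ∈ S, P m) ∧ S.Pairwise Measure.MutuallySingular} (by
      intro c hc hchain
      refine ⟨⋃₀ c, ⟨fun m hm => ?_, ?_⟩, fun s hs => Set.subset_sUnion_of_mem hs⟩
      · obtain ⟨s, hs, hms⟩ := hm
        exact (hc hs).1 m hms
      · exact (Set.pairwise_sUnion hchain.directedOn).2 fun s hs => (hc hs).2)
  refine ⟨S, hS.prop.1, hS.prop.2, fun m hm hmS => ?_⟩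
  have h1 : insert m S ∈
      {S : Set (Measure K) | (∀ m ∈ S, P m) ∧ S.Pairwise Measure.MutuallySingular} := by
    refine ⟨?_, ?_⟩
    · rintro l (rfl | hl)
      · exact hm
      · exact hS.prop.1 l hl
    · exact hS.prop.2.insert fun l hl _ => ⟨hmS l hl, (hmS l hl).symm⟩
  have h2 : m ∈ S := hS.le_of_ge h1 (Set.subset_insert m S) (Set.mem_insert m S)
  exact (Measure.MutuallySingular.self_iff m).1 (hmS m h2)

end BandDecomposition

/-! ### Push-forwards of measures with density -/

section Push

variable {Ω K : Type*} [MeasurableSpace Ω] [MeasurableSpace K]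

/-- The push-forward under `p` of the complex measure with density `F` with respect to `m`. -/
def pushDensity (m : Measure Ω) (p : Ω → K) (F : Ω → ℂ) : ComplexMeasure K :=
  (m.withDensityᵥ F).map p

variable {m : Measure Ω} {p : Ω → K} {F G : Ω → ℂ}

theorem pushDensity_apply (hp : Measurable p) (hF : Integrable F m) {s : Set K}
    (hs : MeasurableSet s) : pushDensity m p F s = ∫ x in p ⁻¹' s, F x ∂m := by
  rw [pushDensity, VectorMeasure.map_apply _ hp hs, withDensityᵥ_apply hF (hp hs)]

theorem pushDensity_add (hF : Integrable F m) (hG : Integrable G m) :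
    pushDensity m p (F + G) = pushDensity m p F + pushDensity m p G := by
  rw [pushDensity, withDensityᵥ_add hF hG, VectorMeasure.map_add]; rfl

theorem pushDensity_smul (c : ℂ) : pushDensity m p (c • F) = c • pushDensity m p F := by
  rw [pushDensity, withDensityᵥ_smul, VectorMeasure.map_smul]; rfl

theorem pushDensity_congr (h : F =ᵐ[m] G) : pushDensity m p F = pushDensity m p G := by
  rw [pushDensity, WithDensityᵥEq.congr_ae h]; rfl

theorem variation_pushDensity_le (hF : Integrable F m) :
    (pushDensity m p F).variation ≤ (m.withDensity fun x => ‖F x‖ₑ).map p := by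
  rw [← Measure.variation_withDensityᵥ hF]
  exact VectorMeasure.variation_map_le

theorem isFiniteMeasure_withDensity_enorm (hF : Integrable F m) :
    IsFiniteMeasure (m.withDensity fun x => ‖F x‖ₑ) := by
  rw [← Measure.variation_withDensityᵥ hF]; infer_instance

theorem norm_pushDensity_le (hp : Measurable p) (hF : Integrable F m) :
    ‖pushDensity m p F‖ ≤ ∫ x, ‖F x‖ ∂m := by
  have := isFiniteMeasure_withDensity_enorm hF
  rw [← norm_withDensityᵥ hF, norm_eq_variation, norm_eq_variation,
    Measure.variation_withDensityᵥ hF, measureReal_def, measureReal_def]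
  refine ENNReal.toReal_mono (measure_ne_top _ _) ((variation_pushDensity_le hF _).trans ?_)
  rw [Measure.map_apply hp MeasurableSet.univ, Set.preimage_univ]

/-- The variation of the push-forward is dominated by the push-forward of `|F| m`, a finite measure
even when `m` is not σ-finite. So `ν` has a density `k` with respect to the latter, and `G = |F| *
(k ∘ p)` works. -/
theorem exists_pushDensity_eq_of_absolutelyContinuous (hp : Measurable p) (hF : Integrable F m)
    {ν : ComplexMeasure K} (hν : ν.variation ≪ (pushDensity m p F).variation) :
    ∃ G, Integrable G m ∧ pushDensity m p G = ν := by
  have := isFiniteMeasure_withDensity_enorm hF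
  have hle := variation_pushDensity_le (p := p) hF
  obtain ⟨k, hk, rfl⟩ := exists_eq_withDensityᵥ ν _ (hν.trans hle.absolutelyContinuous)
  have hkp : Integrable (k ∘ p) (m.withDensity fun x => ‖F x‖ₑ) :=
    hk.comp_measurable hp
  have htop : ∀ᵐ x ∂m, ‖F x‖ₑ < ∞ := Eventually.of_forall fun x => enorm_lt_top
  have hG : Integrable (fun x => (‖F x‖ₑ).toReal • k (p x)) m :=
    (integrable_withDensity_iff_integrable_smul₀' hF.aestronglyMeasurable.enorm htop).1 hkp
  refine ⟨_, hG, ?_⟩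
  ext s hs
  rw [pushDensity_apply hp hG hs, withDensityᵥ_apply hk hs,
    setIntegral_map hs hk.aestronglyMeasurable hp.aemeasurable,
    setIntegral_withDensity_eq_setIntegral_toReal_smul₀ hF.aestronglyMeasurable.enorm.restrict
      (ae_restrict_of_ae htop) _ (hp hs)]

end Push

/-! ### `L¹` of a disjoint union of mutually singular measures -/

section SumMeasure

variable {I K : Type*} [MeasurableSpace I] [MeasurableSpace K]

/-- The disjoint union, on `I × K`, of a family of measures on `K`. -/
def unionMeasure (l : I → Measure K) : Measure (I × K) :=
  Measure.sum fun i => (l i).map (Prod.mk i)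

variable {l : I → Measure K}

theorem map_prodMk_le_unionMeasure (i : I) : (l i).map (Prod.mk i) ≤ unionMeasure l :=
  Measure.le_sum _ i

theorem integrable_comp_prodMk {F : I × K → ℂ} (hF : Integrable F (unionMeasure l)) (i : I) :
    Integrable (fun x => F (i, x)) (l i) :=
  (hF.mono_measure (map_prodMk_le_unionMeasure i)).comp_measurable measurable_prodMk_left

variable [DiscreteMeasurableSpace I]

theorem restrict_unionMeasure (i : I) :
    (unionMeasure l).restrict (Prod.fst ⁻¹' {i}) = (l i).map (Prod.mk i) := by
  have hm : MeasurableSet (Prod.fst ⁻¹' {i} : Set (I × K)) := measurable_fst (.singleton i)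
  ext s hs
  rw [Measure.restrict_apply hs, unionMeasure, Measure.sum_apply _ (hs.inter hm),
    tsum_eq_single i]
  · rw [Measure.map_apply measurable_prodMk_left (hs.inter hm),
      Measure.map_apply measurable_prodMk_left hs]
    congr 1 with x
    simp
  · intro j hj
    rw [Measure.map_apply measurable_prodMk_left (hs.inter hm)]
    have : Prod.mk j ⁻¹' (s ∩ Prod.fst ⁻¹' {i}) = ∅ := by
      ext x; simp [hj]
    rw [this, measure_empty]

theorem pushDensity_indicator_singleton {F : I × K → ℂ} (hF : Integrable F (unionMeasure l))
    (i : I) : pushDensity (unionMeasure l) Prod.snd ((Prod.fst ⁻¹' {i}).indicator F) =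
      (l i).withDensityᵥ fun x => F (i, x) := by
  have hm : MeasurableSet (Prod.fst ⁻¹' {i} : Set (I × K)) := measurable_fst (.singleton i)
  have hFi := hF.mono_measure (map_prodMk_le_unionMeasure i)
  ext s hs
  rw [pushDensity_apply measurable_snd (hF.indicator hm) hs,
    withDensityᵥ_apply (integrable_comp_prodMk hF i) hs, setIntegral_indicator hm,
    ← Measure.restrict_restrict (measurable_snd hs), restrict_unionMeasure,
    setIntegral_map (measurable_snd hs) hFi.aestronglyMeasurable
      measurable_prodMk_left.aemeasurable]
  rfl

theorem integral_norm_indicator_singleton (F : I × K → ℂ) (i : I) :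
    ∫ x, ‖F (i, x)‖ ∂(l i) = ∫ z in Prod.fst ⁻¹' {i}, ‖F z‖ ∂(unionMeasure l) := by
  rw [restrict_unionMeasure, (measurableEmbedding_prodMk_left i).integral_map]

theorem hasSum_setIntegral_norm {F : I × K → ℂ} (hF : Integrable F (unionMeasure l)) :
    HasSum (fun i => ∫ z in Prod.fst ⁻¹' {i}, ‖F z‖ ∂(unionMeasure l))
      (∫ z, ‖F z‖ ∂(unionMeasure l)) := by
  simp only [restrict_unionMeasure]
  exact hasSum_integral_measure hF.norm

theorem setIntegral_norm_finset {F : I × K → ℂ} (hF : Integrable F (unionMeasure l))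
    (J : Finset I) : ∫ z in Prod.fst ⁻¹' (J : Set I), ‖F z‖ ∂(unionMeasure l) =
      ∑ i ∈ J, ∫ z in Prod.fst ⁻¹' {i}, ‖F z‖ ∂(unionMeasure l) := by
  have e : (Prod.fst ⁻¹' (J : Set I) : Set (I × K)) = ⋃ i ∈ J, Prod.fst ⁻¹' {i} := by
    ext z; simp
  rw [e, integral_biUnion_finset]
  · exact fun i _ => measurable_fst (.singleton i)
  · intro i _ j _ hij
    exact Set.disjoint_left.2 fun z hz hz' => hij (hz.symm.trans hz')
  · exact fun i _ => hF.norm.integrableOn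

/-- Slices are added one at a time, using additivity of the norm on singular measures. The second
conjunct strengthens the induction: it says that the next slice is singular to what has been
accumulated. -/
theorem norm_add_pushDensity_finset (hl : Pairwise fun i j => l i ⟂ₘ l j)
    {β : ComplexMeasure K} (hβ : ∀ i, β.variation ⟂ₘ l i) {F : I × K → ℂ}
    (hF : Integrable F (unionMeasure l)) (J : Finset I) :
    ‖β + pushDensity (unionMeasure l) Prod.snd ((Prod.fst ⁻¹' (J : Set I)).indicator F)‖ =
      ‖β‖ + ∑ i ∈ J, ∫ z in Prod.fst ⁻¹' {i}, ‖F z‖ ∂(unionMeasure l) ∧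
    ∀ k ∉ J, (β + pushDensity (unionMeasure l) Prod.snd
      ((Prod.fst ⁻¹' (J : Set I)).indicator F)).variation ⟂ₘ l k := by
  classical
  induction J using Finset.induction_on with
  | empty =>
    have h0 : pushDensity (unionMeasure l) Prod.snd (0 : I × K → ℂ) = 0 := by
      have := pushDensity_smul (m := unionMeasure l) (p := Prod.snd) (F := (0 : I × K → ℂ)) 0
      rwa [zero_smul, zero_smul] at this
    have h1 : ((Prod.fst ⁻¹' ((∅ : Finset I) : Set I)).indicator F) = (0 : I × K → ℂ) := by
      ext; simp
    rw [h1, h0, add_zero]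
    exact ⟨by simp, fun k _ => hβ k⟩
  | insert i J hi ih =>
    have hmJ : MeasurableSet (Prod.fst ⁻¹' (J : Set I) : Set (I × K)) :=
      measurable_fst (MeasurableSet.of_discrete)
    have hmi : MeasurableSet (Prod.fst ⁻¹' {i} : Set (I × K)) := measurable_fst (.singleton i)
    have e : (Prod.fst ⁻¹' ((insert i J : Finset I) : Set I)).indicator F =
        (Prod.fst ⁻¹' (J : Set I)).indicator F + (Prod.fst ⁻¹' {i}).indicator F := by
      ext z
      by_cases h1 : z.1 = i
      · have h2 : z.1 ∉ J := h1 ▸ hi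
        simp [Set.indicator, h1, hi]
      · simp [Set.indicator, h1]
    have hFi := integrable_comp_prodMk hF i
    have hac : ((l i).withDensityᵥ fun x => F (i, x)).variation ≪ l i := by
      rw [Measure.variation_withDensityᵥ hFi]
      exact withDensity_absolutelyContinuous _ _
    rw [e, pushDensity_add (hF.indicator hmJ) (hF.indicator hmi), ← add_assoc,
      pushDensity_indicator_singleton hF]
    refine ⟨?_, fun k hk => ?_⟩
    · rw [norm_add_of_mutuallySingular ((ih.2 i hi).mono_ac Measure.AbsolutelyContinuous.rfl hac),
        ih.1, norm_withDensityᵥ hFi, Finset.sum_insert hi, integral_norm_indicator_singleton]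
      ring
    · rw [Finset.mem_insert, not_or] at hk
      exact ((ih.2 k hk.2).add_left ((hl (Ne.symm hk.1)).mono_ac hac
        Measure.AbsolutelyContinuous.rfl)).mono VectorMeasure.variation_add_le le_rfl

theorem norm_add_pushDensity (hl : Pairwise fun i j => l i ⟂ₘ l j)
    {β : ComplexMeasure K} (hβ : ∀ i, β.variation ⟂ₘ l i) {F : I × K → ℂ}
    (hF : Integrable F (unionMeasure l)) :
    ‖β + pushDensity (unionMeasure l) Prod.snd F‖ =
      ‖β‖ + ∫ z, ‖F z‖ ∂(unionMeasure l) := by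
  refine le_antisymm ((norm_add_le _ _).trans (by
    gcongr; exact norm_pushDensity_le measurable_snd hF)) ?_
  set b : I → ℝ := fun i => ∫ z in Prod.fst ⁻¹' {i}, ‖F z‖ ∂(unionMeasure l) with hb
  set c := ∫ z, ‖F z‖ ∂(unionMeasure l) with hc
  -- Discarding the slices outside `J` changes the norm by at most their `L¹` mass `c - ∑ i ∈ J, b
  -- i`, which tends to `0` along finite sets.
  have key : ∀ J : Finset I, ‖β‖ + ∑ i ∈ J, b i - (c - ∑ i ∈ J, b i) ≤
      ‖β + pushDensity (unionMeasure l) Prod.snd F‖ := by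
    intro J
    have hm : MeasurableSet (Prod.fst ⁻¹' (J : Set I) : Set (I × K)) :=
      measurable_fst (MeasurableSet.of_discrete)
    have e1 : pushDensity (unionMeasure l) Prod.snd F =
        pushDensity (unionMeasure l) Prod.snd ((Prod.fst ⁻¹' (J : Set I)).indicator F) +
        pushDensity (unionMeasure l) Prod.snd ((Prod.fst ⁻¹' (J : Set I))ᶜ.indicator F) := by
      rw [← pushDensity_add (hF.indicator hm) (hF.indicator hm.compl),
        Set.indicator_self_add_compl]
    have e2 : ‖pushDensity (unionMeasure l) Prod.snd
        ((Prod.fst ⁻¹' (J : Set I))ᶜ.indicator F)‖ ≤ c - ∑ i ∈ J, b i := by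
      refine (norm_pushDensity_le measurable_snd (hF.indicator hm.compl)).trans_eq ?_
      simp only [norm_indicator_eq_indicator_norm]
      rw [integral_indicator hm.compl, setIntegral_compl hm hF.norm, setIntegral_norm_finset hF]
    rw [e1, ← add_assoc, ← (norm_add_pushDensity_finset hl hβ hF J).1]
    have e3 := norm_add_le
      (β + pushDensity (unionMeasure l) Prod.snd ((Prod.fst ⁻¹' (J : Set I)).indicator F) +
        pushDensity (unionMeasure l) Prod.snd ((Prod.fst ⁻¹' (J : Set I))ᶜ.indicator F))
      (-pushDensity (unionMeasure l) Prod.snd ((Prod.fst ⁻¹' (J : Set I))ᶜ.indicator F))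
    rw [add_neg_cancel_right, norm_neg] at e3
    linarith
  have hs : HasSum b c := hasSum_setIntegral_norm hF
  have ht : Tendsto (fun J : Finset I => ‖β‖ + ∑ i ∈ J, b i - (c - ∑ i ∈ J, b i)) atTop
      (𝓝 (‖β‖ + c - (c - c))) := (hs.const_add _).sub (hs.const_sub _)
  rw [sub_self, sub_zero] at ht
  exact le_of_tendsto' ht key

/-- The isometric embedding of `L¹` of a disjoint union of mutually singular measures. -/
def pushLp (hl : Pairwise fun i j => l i ⟂ₘ l j) :
    Lp ℂ 1 (unionMeasure l) →ₗᵢ[ℂ] ComplexMeasure K where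
  toFun F := pushDensity (unionMeasure l) Prod.snd F
  map_add' F G := by
    rw [pushDensity_congr (Lp.coeFn_add F G),
      pushDensity_add (L1.integrable_coeFn F) (L1.integrable_coeFn G)]
  map_smul' c F := by
    rw [pushDensity_congr (Lp.coeFn_smul c F), pushDensity_smul]; rfl
  norm_map' F := by
    have h := norm_add_pushDensity hl (β := 0) (fun i => by simp) (L1.integrable_coeFn F)
    rw [zero_add, norm_zero, zero_add, ← L1.norm_eq_integral_norm] at h
    exact h

theorem pushLp_apply (hl : Pairwise fun i j => l i ⟂ₘ l j) (F : Lp ℂ 1 (unionMeasure l)) :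
    pushLp hl F = pushDensity (unionMeasure l) Prod.snd F := rfl

theorem norm_add_pushLp (hl : Pairwise fun i j => l i ⟂ₘ l j)
    {β : ComplexMeasure K} (hβ : ∀ i, β.variation ⟂ₘ l i) (F : Lp ℂ 1 (unionMeasure l)) :
    ‖β + pushLp hl F‖ = ‖β‖ + ‖F‖ := by
  rw [pushLp_apply, norm_add_pushDensity hl hβ (L1.integrable_coeFn F), L1.norm_eq_integral_norm]

theorem pushDensity_mem_range_pushLp (hl : Pairwise fun i j => l i ⟂ₘ l j) {F : I × K → ℂ}
    (hF : Integrable F (unionMeasure l)) :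
    pushDensity (unionMeasure l) Prod.snd F ∈ LinearMap.range (pushLp hl).toLinearMap :=
  ⟨hF.toL1 F, pushDensity_congr hF.coeFn_toL1⟩

theorem isBand_range_pushLp (hl : Pairwise fun i j => l i ⟂ₘ l j) :
    IsBand (LinearMap.range (pushLp hl).toLinearMap) := by
  refine ⟨?_, ?_⟩
  · have h1 := (pushLp hl).isometry.isClosedEmbedding.isClosed_range
    exact h1
  · rintro _ ⟨F, rfl⟩ ν hν
    obtain ⟨G, hG, rfl⟩ := exists_pushDensity_eq_of_absolutelyContinuous measurable_snd
      (L1.integrable_coeFn F) hν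
    exact pushDensity_mem_range_pushLp hl hG

/-- The density `1` on the `i`th slice does this. It turns singularity to the range of `pushLp` into
singularity to each `l i`. -/
theorem exists_mem_range_pushLp_variation_eq (hl : Pairwise fun i j => l i ⟂ₘ l j) (i : I)
    [IsFiniteMeasure (l i)] :
    ∃ μ ∈ LinearMap.range (pushLp hl).toLinearMap, μ.variation = l i := by
  have hm : MeasurableSet (Prod.fst ⁻¹' {i} : Set (I × K)) := measurable_fst (.singleton i)
  have hfin : unionMeasure l (Prod.fst ⁻¹' {i}) ≠ ∞ := by
    rw [← Measure.restrict_apply_univ, restrict_unionMeasure,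
      Measure.map_apply measurable_prodMk_left MeasurableSet.univ]
    exact measure_ne_top _ _
  have hF : Integrable ((Prod.fst ⁻¹' {i}).indicator fun _ => (1 : ℂ)) (unionMeasure l) :=
    (integrable_indicator_iff hm).2 (integrableOn_const hfin)
  refine ⟨_, pushDensity_mem_range_pushLp hl hF, ?_⟩
  have e := pushDensity_indicator_singleton hF i
  rw [Set.indicator_indicator, Set.inter_self] at e
  rw [e, Measure.variation_withDensityᵥ (integrable_comp_prodMk hF i)]
  simp

end SumMeasure

/-! ### The `ℓ¹`-complement of a band and its image in `X^*` -/

section Decomposition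

variable {K : Type u}

/-- Every measure is the sum of a measure in the band `B` and of a measure in an `L¹`-space of
measures singular to `B`, with additivity of the norms. -/
theorem IsBand.exists_l1_complement [MeasurableSpace K] {B : Submodule ℂ (ComplexMeasure K)}
    (hB : IsBand B) :
    ∃ (Ω : Type u) (_ : MeasurableSpace Ω) (m : Measure Ω) (T : Lp ℂ 1 m →ₗᵢ[ℂ] ComplexMeasure K),
      (∀ β ∈ B, ∀ F, ‖β + T F‖ = ‖β‖ + ‖F‖) ∧ ∀ ν, ∃ β ∈ B, ∃ F, ν = β + T F := by
  obtain ⟨S, hSP, hSd, hSmax⟩ := exists_maximal_mutuallySingular (K := K)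
    fun m => IsFiniteMeasure m ∧ ∀ β ∈ B, β.variation ⟂ₘ m
  obtain ⟨I, l, hfin, hl, hlB, hmax⟩ : ∃ (I : Type u) (l : I → Measure K),
      (∀ i, IsFiniteMeasure (l i)) ∧ (Pairwise fun i j => l i ⟂ₘ l j) ∧
      (∀ β ∈ B, ∀ i, β.variation ⟂ₘ l i) ∧
      ∀ m : Measure K, IsFiniteMeasure m → (∀ β ∈ B, β.variation ⟂ₘ m) → (∀ i, m ⟂ₘ l i) → m = 0 :=
    ⟨S, Subtype.val, fun i => (hSP i i.2).1,
      fun i j hij => hSd i.2 j.2 fun h => hij (Subtype.ext h), fun β hβ i => (hSP i i.2).2 β hβ,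
      fun m h1 h2 h3 => hSmax m ⟨h1, h2⟩ fun l hl => h3 ⟨l, hl⟩⟩
  -- The discrete σ-algebra makes every union of slices measurable, even for uncountable `I`.
  let _ : MeasurableSpace I := ⊤
  refine ⟨I × K, inferInstance, unionMeasure l, pushLp hl,
    fun β hβ F => norm_add_pushLp hl (hlB β hβ) F, fun ν => ?_⟩
  obtain ⟨β, hβ, σ, rfl, -, hσB⟩ := hB.exists_decomposition ν
  obtain ⟨_, ⟨F, rfl⟩, τ, rfl, hτ, hτT⟩ := (isBand_range_pushLp hl).exists_decomposition σ
  -- What remains is singular to `B` and to every `l i`, so maximality of the family forces it to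
  -- vanish.
  have h0 : τ.variation = 0 := by
    refine hmax _ inferInstance (fun γ hγ => ((hσB γ hγ).mono hτ le_rfl).symm) fun i => ?_
    obtain ⟨μ, hμ, he⟩ := exists_mem_range_pushLp_variation_eq hl i
    rw [← he]
    exact hτT μ hμ
  rw [VectorMeasure.variation_eq_zero] at h0
  refine ⟨β, hβ, F, ?_⟩
  rw [h0, add_zero]
  rfl

variable [MetricSpace K] [CompactSpace K] [MeasurableSpace K] [BorelSpace K]

/-- The norm in `X^*` is a minimum over translates by `X^⊥ ⊆ B`. Such a translation alters only the
component in `B`, and the norm is additive before restriction. -/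
theorem norm_restrictDual_add {X : Submodule ℂ C(K, ℂ)} {B : Submodule ℂ (ComplexMeasure K)}
    (hXB : annihilator X ≤ B) {E : Type*} [NormedAddCommGroup E] [NormedSpace ℂ E]
    {T : E →ₗᵢ[ℂ] ComplexMeasure K} (hT : ∀ β ∈ B, ∀ F, ‖β + T F‖ = ‖β‖ + ‖F‖)
    {β : ComplexMeasure K} (hβ : β ∈ B) (F : E) :
    ‖restrictDual X (β + T F)‖ = ‖restrictDual X β‖ + ‖F‖ := by
  apply le_antisymm
  · obtain ⟨ν, hν, h⟩ := exists_annihilator_norm_add_eq X β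
    have e : restrictDual X (β + T F) = restrictDual X (β + ν + T F) := by
      rw [map_add, map_add, map_add, mem_annihilator_iff.1 hν, add_zero]
    rw [e, ← h, ← hT _ (B.add_mem hβ (hXB hν))]
    exact norm_restrictDual_le _ _
  · obtain ⟨ν, hν, h⟩ := exists_annihilator_norm_add_eq X (β + T F)
    have e : restrictDual X β = restrictDual X (β + ν) := by
      rw [map_add, mem_annihilator_iff.1 hν, add_zero]
    rw [← h, add_right_comm, hT _ (B.add_mem hβ (hXB hν)), e]
    gcongr
    exact norm_restrictDual_le _ _

end Decomposition

/-! ### Passing an `ℓ¹`-decomposition to a quotient -/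

section Abstract

variable {V Y E : Type*} [AddCommGroup V] [Module ℂ V] [NormedAddCommGroup Y] [NormedSpace ℂ Y]
  [NormedAddCommGroup E] [NormedSpace ℂ E]

/-- The distance from `ρ (β + T F)` to `ρ(B)` is at least `‖F‖`, so a limit point has `F = 0`.
Closedness is what makes the separable summand complete. -/
theorem isClosed_map_of_norm_add {ρ : V →ₗ[ℂ] Y} (hρ : Function.Surjective ρ)
    {B : Submodule ℂ V} {T : E →ₗ[ℂ] V} (hn : ∀ β ∈ B, ∀ F, ‖ρ (β + T F)‖ = ‖ρ β‖ + ‖F‖)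
    (hs : ∀ ν, ∃ β ∈ B, ∃ F, ν = β + T F) : IsClosed (B.map ρ : Set Y) := by
  refine isClosed_of_closure_subset fun y hy => ?_
  obtain ⟨ν, rfl⟩ := hρ y
  obtain ⟨β, hβ, F, rfl⟩ := hs ν
  have hF : ‖F‖ = 0 := by
    refine (norm_nonneg F).antisymm' (le_of_forall_pos_le_add fun ε hε => ?_)
    obtain ⟨_, ⟨γ, hγ, rfl⟩, hd⟩ := Metric.mem_closure_iff.1 hy ε hε
    rw [dist_eq_norm, ← map_sub, add_sub_right_comm, hn _ (B.sub_mem hβ hγ)] at hd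
    have := norm_nonneg (ρ (β - γ))
    linarith
  rw [norm_eq_zero.1 hF, map_zero, add_zero]
  exact ⟨β, hβ, rfl⟩

theorem nonempty_linearIsometryEquiv_prod {ρ : V →ₗ[ℂ] Y} (hρ : Function.Surjective ρ)
    {B : Submodule ℂ V} {T : E →ₗ[ℂ] V} (hn : ∀ β ∈ B, ∀ F, ‖ρ (β + T F)‖ = ‖ρ β‖ + ‖F‖)
    (hs : ∀ ν, ∃ β ∈ B, ∃ F, ν = β + T F) :
    Nonempty (Y ≃ₗᵢ[ℂ] WithLp 1 (B.map ρ × E)) := by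
  let L : WithLp 1 (B.map ρ × E) →ₗᵢ[ℂ] Y :=
    { toLinearMap := ((B.map ρ).subtype.coprod (ρ ∘ₗ T)) ∘ₗ
        (WithLp.linearEquiv 1 ℂ (B.map ρ × E)).toLinearMap
      norm_map' := fun z => by
        obtain ⟨β, hβ, h⟩ := z.fst.2
        have e : ((B.map ρ).subtype.coprod (ρ ∘ₗ T)) (WithLp.linearEquiv 1 ℂ (B.map ρ × E) z) =
            ρ (β + T z.snd) := by
          rw [map_add, h]; rfl
        rw [LinearMap.comp_apply]
        refine (congrArg norm e).trans ?_
        rw [hn β hβ, WithLp.prod_norm_eq_of_L1, h]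
        rfl }
  have hsurj : Function.Surjective L := fun y => by
    obtain ⟨ν, rfl⟩ := hρ y
    obtain ⟨β, hβ, F, rfl⟩ := hs ν
    refine ⟨WithLp.toLp 1 (⟨ρ β, β, hβ, rfl⟩, F), ?_⟩
    rw [map_add]; rfl
  exact ⟨(LinearIsometryEquiv.ofSurjective L hsurj).symm⟩

theorem isSeparableDistortionOfL1_of_norm_add {W : Type*} [AddCommGroup W] [Module ℂ W]
    {Z : Type u} [NormedAddCommGroup Z] [NormedSpace ℂ Z] [CompleteSpace Z] {Ω : Type u}
    [MeasurableSpace Ω] {m : Measure Ω} {ρ : W →ₗ[ℂ] Z} (hρ : Function.Surjective ρ)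
    {B : Submodule ℂ W} (hsep : IsSeparable (ρ '' B)) {T : Lp ℂ 1 m →ₗ[ℂ] W}
    (hn : ∀ β ∈ B, ∀ F, ‖ρ (β + T F)‖ = ‖ρ β‖ + ‖F‖)
    (hs : ∀ ν, ∃ β ∈ B, ∃ F, ν = β + T F) : IsSeparableDistortionOfL1 Z :=
  ⟨B.map ρ, inferInstance, inferInstance, (isClosed_map_of_norm_add hρ hn hs).completeSpace_coe, Ω,
    inferInstance, m, IsSeparable.separableSpace hsep, nonempty_linearIsometryEquiv_prod hρ hn hs⟩

end Abstract

end TightSubspace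

end

theorem proposition3p2 {K : Type*} [MetricSpace K] [CompactSpace K] [MeasurableSpace K]
    [BorelSpace K] (X : Submodule ℂ C(K, ℂ)) (hX : TightSubspace.IsTight X) :
    SeparableSpace
      (TightSubspace.generatedBand (TightSubspace.annihilator X : Set (ComplexMeasure K)) ⧸
        (TightSubspace.annihilator X).submoduleOf
          (TightSubspace.generatedBand
            (TightSubspace.annihilator X : Set (ComplexMeasure K)))) ∧
    TightSubspace.IsSeparableDistortionOfL1 (StrongDual ℂ X) := by
  have hXB := TightSubspace.subset_generatedBand
    (TightSubspace.annihilator X : Set (ComplexMeasure K))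
  have hsep := TightSubspace.isSeparable_restrictDual_image hX
  refine ⟨TightSubspace.separableSpace_quotient hXB hsep, ?_⟩
  obtain ⟨Ω, _, m, T, hT, hs⟩ := (TightSubspace.isBand_generatedBand
    (TightSubspace.annihilator X : Set (ComplexMeasure K))).exists_l1_complement
  have hρ : Function.Surjective (TightSubspace.restrictDual X) := fun ψ =>
    (TightSubspace.exists_restrictDual_eq X ψ).imp fun _ h => h.1
  have hn := fun β hβ F => TightSubspace.norm_restrictDual_add hXB hT (β := β) hβ F
  exact TightSubspace.isSeparableDistortionOfL1_of_norm_add (Z := StrongDual ℂ X)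
    (T := T.toLinearMap) hρ hsep hn hs
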